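/- Let $\Bbbk$ be a field; all algebras are finite-dimensional, associative and unital over $\Bbbk$, and all bimodules are finite-dimensional with $\Bbbk$ acting centrally. For algebras $A$ and $B$, write $B\leq_J A$ if there are bimodules ${}_AM_B$ and ${}_BN_A$ such that $M\otimes_B N\simeq A\oplus X$ as $A$-$A$-bimodules for some $A$-$A$-bimodule $X$. If $M$ and $N$ can moreover be chosen left-right projective (that is, projective as left modules and projective as right modules), then we say that $A$ separably divides $B$. We call $A$ and $B$ separably related if $A$ separably divides $B$ or $B$ separably divides $A$. An algebra is directed if it is isomorphic to $\Bbbk Q/I$ for a finite acyclic quiver $Q$ and an admissible ideal $I$, and self-injective if its regular module is injective. Let $A$ and $B$ be non-semisimple $\Bbbk$-algebras. If $A$ is directed and $B$ is self-injective, then $A$ and $B$ are not separably related. In particular, the following $J$-inequalities do not come from separable division. (a) Let $\Theta$ be the path algebra of the Kronecker quiver (two vertices $1,2$ and two arrows $1\to 2$). Then $\Theta\leq_J \Bbbk[x]/(x^2)$, but $\Bbbk[x]/(x^2)$ does not separably divide $\Theta$. (b) Let $m\geq 2$ and $n\geq 2$, let $\mathbb{A}_m$ be the quiver $1\to 2\to\cdots\to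 m$, and let $R$ be the ideal of $\Bbbk\mathbb{A}_m$ generated by the arrows. Then $\Bbbk[x]/(x^n)\leq_J \Bbbk\mathbb{A}_m/R^n$, but $\Bbbk\mathbb{A}_m/R^n$ does not separably divide $\Bbbk[x]/(x^n)$. -/

import Mathlib

open scoped TensorProduct Polynomial
open MulOpposite (op)

universe u v w x

namespace SepRel

/-! ### Bimodules over algebras over a field -/

/-- A finite-dimensional `A`-`B`-bimodule over the field `k`: a `k`-vector space with a left action
of `A` and a right action of `B` (a left action of `Bᵐᵒᵖ`) that commute and that both extend the
action of `k`. As it is finite-dimensional over `k`, nothing is lost by taking the underlying type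
in the universe of `k`. -/
structure Bimodule (k : Type u) (A : Type v) (B : Type w) [Field k] [Ring A] [Algebra k A]
    [Ring B] [Algebra k B] where
  carrier : Type u
  [addCommGroup : AddCommGroup carrier]
  [module : Module k carrier]
  [leftModule : Module A carrier]
  [rightModule : Module Bᵐᵒᵖ carrier]
  [leftTower : IsScalarTower k A carrier]
  [rightTower : IsScalarTower k Bᵐᵒᵖ carrier]
  [smulComm : SMulCommClass A Bᵐᵒᵖ carrier]
  [finite : Module.Finite k carrier]

attribute [instance] Bimodule.addCommGroup Bimodule.module Bimodule.leftModule
  Bimodule.rightModule Bimodule.leftTower Bimodule.rightTower Bimodule.smulComm Bimodule.finite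

section Tensor

variable (k : Type u) (B : Type w) [Field k] [Ring B]
  (M N : Type u) [AddCommGroup M] [Module k M] [Module Bᵐᵒᵖ M]
  [AddCommGroup N] [Module k N] [Module B N]

/-- The subspace of `M ⊗[k] N` spanned by the elements `m b ⊗ n - m ⊗ b n`. -/
def balancing : Submodule k (M ⊗[k] N) :=
  Submodule.span k {t | ∃ (m : M) (b : B) (n : N), t = (op b • m) ⊗ₜ[k] n - m ⊗ₜ[k] (b • n)}

/-- The tensor product `M ⊗_B N` of a right `B`-module and a left `B`-module. -/
abbrev BalancedTensor : Type u := (M ⊗[k] N) ⧸ balancing k B M N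

variable {M N}

/-- The class of the elementary tensor `m ⊗ n` in `M ⊗_B N`. -/
def tmul (m : M) (n : N) : BalancedTensor k B M N :=
  (balancing k B M N).mkQ (m ⊗ₜ[k] n)

variable {k B}

theorem BalancedTensor.induction {p : BalancedTensor k B M N → Prop} (t : BalancedTensor k B M N)
    (h0 : p 0) (ht : ∀ m n, p (tmul k B m n))
    (ha : ∀ s t, p s → p t → p (s + t)) : p t := by
  obtain ⟨t, rfl⟩ := (balancing k B M N).mkQ_surjective t
  induction t with
  | zero => rw [map_zero]; exact h0
  | tmul m n => exact ht m n
  | add s t hs ht => rw [map_add]; exact ha _ _ hs ht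

/-- The map `f ⊗ g` on `M ⊗_B N`, for endomorphisms `f` and `g` that are linear over `k` and
over `B`. -/
noncomputable def BalancedTensor.map (f : M →ₗ[k] M) (g : N →ₗ[k] N)
    (hf : ∀ (b : B) (m : M), f (op b • m) = op b • f m)
    (hg : ∀ (b : B) (n : N), g (b • n) = b • g n) :
    BalancedTensor k B M N →ₗ[k] BalancedTensor k B M N :=
  (balancing k B M N).mapQ (balancing k B M N) (TensorProduct.map f g) (by
    rw [balancing, Submodule.span_le]
    rintro _ ⟨m, b, n, rfl⟩
    refine Submodule.subset_span ⟨f m, b, g n, ?_⟩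
    rw [map_sub, TensorProduct.map_tmul, TensorProduct.map_tmul, hf, hg])

theorem BalancedTensor.map_tmul (f : M →ₗ[k] M) (g : N →ₗ[k] N)
    (hf : ∀ (b : B) (m : M), f (op b • m) = op b • f m)
    (hg : ∀ (b : B) (n : N), g (b • n) = b • g n) (m : M) (n : N) :
    BalancedTensor.map f g hf hg (tmul k B m n) = tmul k B (f m) (g n) := rfl

theorem tmul_add (m : M) (n n' : N) :
    tmul k B m (n + n') = tmul k B m n + tmul k B m n' := by
  simp only [tmul, TensorProduct.tmul_add, map_add]

theorem add_tmul (m m' : M) (n : N) :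
    tmul k B (m + m') n = tmul k B m n + tmul k B m' n := by
  simp only [tmul, TensorProduct.add_tmul, map_add]

theorem tmul_smul (c : k) (m : M) (n : N) : tmul k B m (c • n) = c • tmul k B m n := by
  simp only [tmul, TensorProduct.tmul_smul, map_smul]

theorem smul_tmul (c : k) (m : M) (n : N) : tmul k B (c • m) n = c • tmul k B m n := by
  simp only [tmul, ← TensorProduct.smul_tmul', map_smul]

theorem zero_tmul (n : N) : tmul k B (0 : M) n = 0 := by
  simp only [tmul, TensorProduct.zero_tmul, map_zero]

theorem tmul_zero (m : M) : tmul k B m (0 : N) = 0 := by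
  simp only [tmul, TensorProduct.tmul_zero, map_zero]

/-- The left action `a (m ⊗ n) = (a m) ⊗ n` on `M ⊗_B N`. -/
@[reducible]
noncomputable def BalancedTensor.leftModule (A : Type v) [Ring A] [Algebra k A] [Module A M]
    [IsScalarTower k A M] [SMulCommClass A Bᵐᵒᵖ M] : Module A (BalancedTensor k B M N) where
  smul a := BalancedTensor.map (Algebra.lsmul k k M a) LinearMap.id
    (fun b m => smul_comm a (op b) m) (fun _ _ => rfl)
  smul_zero a := map_zero (BalancedTensor.map _ _ _ _)
  smul_add a := map_add (BalancedTensor.map _ _ _ _)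
  one_smul t := by
    induction t using BalancedTensor.induction with
    | h0 => exact map_zero (BalancedTensor.map _ _ _ _)
    | ht m n => exact congrArg (tmul k B · n) (one_smul A m)
    | ha s t hs ht => exact (map_add (BalancedTensor.map _ _ _ _) s t).trans (congrArg₂ _ hs ht)
  mul_smul a a' t := by
    induction t using BalancedTensor.induction with
    | h0 =>
      change BalancedTensor.map _ _ _ _ 0 =
        BalancedTensor.map _ _ _ _ (BalancedTensor.map _ _ _ _ 0)
      simp only [map_zero]
    | ht m n => exact congrArg (tmul k B · n) (mul_smul a a' m)
    | ha s t hs ht =>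
      change BalancedTensor.map _ _ _ _ (s + t) =
        BalancedTensor.map _ _ _ _ (BalancedTensor.map _ _ _ _ (s + t))
      simp only [map_add]
      exact congrArg₂ _ hs ht
  zero_smul t := by
    induction t using BalancedTensor.induction with
    | h0 => exact map_zero (BalancedTensor.map _ _ _ _)
    | ht m n => exact (congrArg (tmul k B · n) (zero_smul A m)).trans (zero_tmul n)
    | ha s t hs ht =>
      exact (map_add (BalancedTensor.map _ _ _ _) s t).trans
        ((congrArg₂ _ hs ht).trans (add_zero 0))
  add_smul a a' t := by
    induction t using BalancedTensor.induction with
    | h0 =>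
      change BalancedTensor.map _ _ _ _ 0 =
        BalancedTensor.map _ _ _ _ 0 + BalancedTensor.map _ _ _ _ 0
      simp only [map_zero, add_zero]
    | ht m n => exact (congrArg (tmul k B · n) (add_smul a a' m)).trans (add_tmul _ _ n)
    | ha s t hs ht =>
      change BalancedTensor.map _ _ _ _ (s + t) =
        BalancedTensor.map _ _ _ _ (s + t) + BalancedTensor.map _ _ _ _ (s + t)
      simp only [LinearMap.map_add]
      exact (congrArg₂ _ hs ht).trans (add_add_add_comm _ _ _ _)

/-- The action `c (m ⊗ n) = m ⊗ (c n)` on `M ⊗_B N`, to be used with `C` the opposite of an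
algebra that acts on `N` from the right. -/
@[reducible]
noncomputable def BalancedTensor.rightModule (C : Type x) [Ring C] [Algebra k C] [Module C N]
    [IsScalarTower k C N] [SMulCommClass B C N] : Module C (BalancedTensor k B M N) where
  smul c := BalancedTensor.map LinearMap.id (Algebra.lsmul k k N c)
    (fun _ _ => rfl) (fun b n => (smul_comm b c n).symm)
  smul_zero a := map_zero (BalancedTensor.map _ _ _ _)
  smul_add a := map_add (BalancedTensor.map _ _ _ _)
  one_smul t := by
    induction t using BalancedTensor.induction with
    | h0 => exact map_zero (BalancedTensor.map _ _ _ _)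
    | ht m n => exact congrArg (tmul k B m) (one_smul C n)
    | ha s t hs ht => exact (map_add (BalancedTensor.map _ _ _ _) s t).trans (congrArg₂ _ hs ht)
  mul_smul a a' t := by
    induction t using BalancedTensor.induction with
    | h0 =>
      change BalancedTensor.map _ _ _ _ 0 =
        BalancedTensor.map _ _ _ _ (BalancedTensor.map _ _ _ _ 0)
      simp only [map_zero]
    | ht m n => exact congrArg (tmul k B m) (mul_smul a a' n)
    | ha s t hs ht =>
      change BalancedTensor.map _ _ _ _ (s + t) =
        BalancedTensor.map _ _ _ _ (BalancedTensor.map _ _ _ _ (s + t))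
      simp only [map_add]
      exact congrArg₂ _ hs ht
  zero_smul t := by
    induction t using BalancedTensor.induction with
    | h0 => exact map_zero (BalancedTensor.map _ _ _ _)
    | ht m n => exact (congrArg (tmul k B m) (zero_smul C n)).trans (tmul_zero m)
    | ha s t hs ht =>
      exact (map_add (BalancedTensor.map _ _ _ _) s t).trans
        ((congrArg₂ _ hs ht).trans (add_zero 0))
  add_smul a a' t := by
    induction t using BalancedTensor.induction with
    | h0 =>
      change BalancedTensor.map _ _ _ _ 0 =
        BalancedTensor.map _ _ _ _ 0 + BalancedTensor.map _ _ _ _ 0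
      simp only [map_zero, add_zero]
    | ht m n => exact (congrArg (tmul k B m) (add_smul a a' n)).trans (tmul_add m _ _)
    | ha s t hs ht =>
      change BalancedTensor.map _ _ _ _ (s + t) =
        BalancedTensor.map _ _ _ _ (s + t) + BalancedTensor.map _ _ _ _ (s + t)
      simp only [LinearMap.map_add]
      exact (congrArg₂ _ hs ht).trans (add_add_add_comm _ _ _ _)

end Tensor

section Bimodules

variable {k : Type u} {A : Type v} {B : Type w} {C : Type x} [Field k] [Ring A] [Algebra k A]
  [Ring B] [Algebra k B] [Ring C] [Algebra k C]

/-- The `A`-`C`-bimodule `M ⊗_B N`. -/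
noncomputable def Bimodule.tensor (M : Bimodule k A B) (N : Bimodule k B C) : Bimodule k A C :=
  letI := BalancedTensor.leftModule (k := k) (B := B) (M := M.carrier) (N := N.carrier) A
  letI := BalancedTensor.rightModule (k := k) (B := B) (M := M.carrier) (N := N.carrier) Cᵐᵒᵖ
  { carrier := BalancedTensor k B M.carrier N.carrier
    leftTower := ⟨fun c a t => by
      induction t using BalancedTensor.induction with
      | h0 => simp only [smul_zero]
      | ht m n => exact (congrArg (tmul k B · n) (smul_assoc c a m)).trans (smul_tmul c _ n)
      | ha s t hs ht => simp only [smul_add, hs, ht]⟩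
    rightTower := ⟨fun c a t => by
      induction t using BalancedTensor.induction with
      | h0 => simp only [smul_zero]
      | ht m n => exact (congrArg (tmul k B m) (smul_assoc c a n)).trans (tmul_smul c m _)
      | ha s t hs ht => simp only [smul_add, hs, ht]⟩
    smulComm := ⟨fun a c t => by
      induction t using BalancedTensor.induction with
      | h0 => simp only [smul_zero]
      | ht m n => rfl
      | ha s t hs ht => simp only [smul_add, hs, ht]⟩ }

/-- Left-right projective bimodules: projective as a left module and as a right module. -/
def Bimodule.IsLeftRightProjective (M : Bimodule k A B) : Prop :=
  Module.Projective A M.carrier ∧ Module.Projective Bᵐᵒᵖ M.carrier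

/-- The regular `A`-`A`-bimodule is (isomorphic to) a direct summand of `T`, that is, `T` is
isomorphic to `A ⊕ X` as an `A`-`A`-bimodule, for some `A`-`A`-bimodule `X`. -/
def RegularIsSummand (T : Bimodule k A A) : Prop :=
  ∃ (X : Bimodule k A A) (e : T.carrier ≃+ A × X.carrier),
    (∀ (a : A) (t : T.carrier), e (a • t) = a • e t) ∧
    (∀ (a : A) (t : T.carrier), e (op a • t) = op a • e t)

variable (k A B)

/-- The two-sided preorder: `B ≤_J A` (`JLE k B A`) if the regular `A`-`A`-bimodule is a direct summand of
`M ⊗_B N`, for some bimodules `M` and `N`. -/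
def JLE (k : Type u) (B : Type w) (A : Type v) [Field k] [Ring B] [Algebra k B] [Ring A]
    [Algebra k A] : Prop :=
  ∃ (M : Bimodule k A B) (N : Bimodule k B A), RegularIsSummand (M.tensor N)

/-- `A` separably divides `B`: the regular `A`-`A`-bimodule is a direct summand of `M ⊗_B N`, for
some left-right projective bimodules `M` and `N`. -/
def SeparablyDivides : Prop :=
  ∃ (M : Bimodule k A B) (N : Bimodule k B A), M.IsLeftRightProjective ∧
    N.IsLeftRightProjective ∧ RegularIsSummand (M.tensor N)

/-- `A` and `B` are separably related if one of them separably divides the other. -/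
def SeparablyRelated : Prop := SeparablyDivides k A B ∨ SeparablyDivides k B A

end Bimodules

/-! ### Path algebras of quivers -/

section PathAlgebra

/-- All paths of a quiver: a source, a target and a path between them. -/
abbrev AnyPath (V : Type v) [Quiver.{w} V] := Σ a b : V, Quiver.Path a b

/-- The path algebra `k Q` of a quiver `Q` with set of vertices `V`: the vector space with basis
all paths in `Q`. -/
def PathAlgebra (k : Type u) (V : Type v) [Field k] [Quiver.{w} V] := AnyPath V →₀ k

variable {k : Type u} {V : Type v} [Field k] [Quiver.{w} V]

noncomputable instance : AddCommGroup (PathAlgebra k V) :=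
  inferInstanceAs (AddCommGroup (AnyPath V →₀ k))

noncomputable instance : Module k (PathAlgebra k V) :=
  inferInstanceAs (Module k (AnyPath V →₀ k))

namespace PathAlgebra

variable (k) in
/-- A path as a basis element of the path algebra. -/
noncomputable def ofPath {a b : V} (p : Quiver.Path a b) : PathAlgebra k V :=
  Finsupp.single (⟨a, b, p⟩ : AnyPath V) (1 : k)

open Classical in
variable (k) in
/-- The product `p q` of two paths, composed from right to left: first `q`, then `p` if `q` ends
where `p` starts, and `0` otherwise. -/
noncomputable def pathMul (p q : AnyPath V) : PathAlgebra k V :=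
  if h : q.2.1 = p.1 then ofPath k (q.2.2.comp (p.2.2.cast h.symm rfl)) else 0

/-- The multiplication of the path algebra, the bilinear extension of the product of paths. -/
noncomputable def mulHom : PathAlgebra k V →ₗ[k] PathAlgebra k V →ₗ[k] PathAlgebra k V :=
  Finsupp.linearCombination k fun p : AnyPath V => Finsupp.linearCombination k (pathMul k p)

noncomputable instance : Mul (PathAlgebra k V) := ⟨fun x y => mulHom x y⟩

/-- The unit of the path algebra is the sum of the paths of length zero. -/
noncomputable instance [Fintype V] : One (PathAlgebra k V) :=
  ⟨∑ a : V, ofPath k (Quiver.Path.nil : Quiver.Path a a)⟩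

theorem mul_def (x y : PathAlgebra k V) : x * y = mulHom x y := rfl

theorem one_def [Fintype V] :
    (1 : PathAlgebra k V) = ∑ a : V, ofPath k (Quiver.Path.nil : Quiver.Path a a) := rfl

theorem ofPath_mul_ofPath (p q : AnyPath V) :
    ofPath k p.2.2 * ofPath k q.2.2 = pathMul k p q := by
  have h := Finsupp.linearCombination_single k (v := fun p : AnyPath V =>
    Finsupp.linearCombination k (pathMul k p)) 1 p
  have h' := Finsupp.linearCombination_single k (v := pathMul k p) 1 q
  rw [one_smul] at h h'
  exact (LinearMap.congr_fun h _).trans h'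

theorem ofPath_comp {a b c : V} (q : Quiver.Path a b) (p : Quiver.Path b c) :
    ofPath k p * ofPath k q = ofPath k (q.comp p) := by
  refine (ofPath_mul_ofPath ⟨b, c, p⟩ ⟨a, b, q⟩).trans ?_
  rw [pathMul, dif_pos rfl]
  rfl

theorem ofPath_mul_of_ne {a b c d : V} (p : Quiver.Path c d) (q : Quiver.Path a b) (h : b ≠ c) :
    ofPath k p * ofPath k q = 0 := by
  refine (ofPath_mul_ofPath ⟨c, d, p⟩ ⟨a, b, q⟩).trans ?_
  rw [pathMul, dif_neg h]

theorem induction {P : PathAlgebra k V → Prop} (x : PathAlgebra k V) (h0 : P 0)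
    (hp : ∀ (a b : V) (p : Quiver.Path a b), P (ofPath k p))
    (ha : ∀ x y, P x → P y → P (x + y)) (hs : ∀ (c : k) x, P x → P (c • x)) : P x := by
  induction x using Finsupp.induction_linear with
  | zero => exact h0
  | add f g hf hg => exact ha f g hf hg
  | single p c =>
    have h : (Finsupp.single p c : AnyPath V →₀ k) = c • Finsupp.single p (1 : k) := by
      rw [Finsupp.smul_single, smul_eq_mul, mul_one]
    rw [h]
    exact hs c _ (hp _ _ p.2.2)

theorem add_mul_aux (x y z : PathAlgebra k V) : (x + y) * z = x * z + y * z :=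
  LinearMap.map_add₂ mulHom x y z

theorem mul_add_aux (x y z : PathAlgebra k V) : x * (y + z) = x * y + x * z :=
  map_add (mulHom x) y z

theorem smul_mul_aux (c : k) (x y : PathAlgebra k V) : (c • x) * y = c • (x * y) :=
  LinearMap.map_smul₂ mulHom c x y

theorem mul_smul_aux (c : k) (x y : PathAlgebra k V) : x * (c • y) = c • (x * y) :=
  map_smul (mulHom x) c y

theorem zero_mul_aux (x : PathAlgebra k V) : 0 * x = 0 := LinearMap.map_zero₂ mulHom x

theorem mul_zero_aux (x : PathAlgebra k V) : x * 0 = 0 := map_zero (mulHom x)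

theorem mul_assoc_aux (x y z : PathAlgebra k V) : x * y * z = x * (y * z) := by
  induction x using PathAlgebra.induction with
  | h0 => simp only [zero_mul_aux]
  | ha x x' hx hx' => simp only [add_mul_aux, hx, hx']
  | hs c x hx => simp only [smul_mul_aux, hx]
  | hp a b p =>
    induction y using PathAlgebra.induction with
    | h0 => simp only [zero_mul_aux, mul_zero_aux]
    | ha x x' hx hx' => simp only [add_mul_aux, mul_add_aux, hx, hx']
    | hs c x hx => simp only [smul_mul_aux, mul_smul_aux, hx]
    | hp a' b' q =>
      induction z using PathAlgebra.induction with
      | h0 => simp only [mul_zero_aux]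
      | ha x x' hx hx' => simp only [mul_add_aux, hx, hx']
      | hs c x hx => simp only [mul_smul_aux, hx]
      | hp a'' b'' r =>
        by_cases h : b' = a
        · subst h
          by_cases h' : b'' = a'
          · subst h'
            simp only [ofPath_comp, Quiver.Path.comp_assoc]
          · simp only [ofPath_comp, ofPath_mul_of_ne _ _ h', mul_zero_aux]
        · by_cases h' : b'' = a'
          · subst h'
            simp only [ofPath_comp, ofPath_mul_of_ne _ _ h, zero_mul_aux]
          · simp only [ofPath_mul_of_ne _ _ h', ofPath_mul_of_ne _ _ h, zero_mul_aux, mul_zero_aux]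

theorem one_mul_aux [Fintype V] (x : PathAlgebra k V) : 1 * x = x := by
  induction x using PathAlgebra.induction with
  | h0 => exact mul_zero_aux 1
  | ha x x' hx hx' => rw [mul_add_aux, hx, hx']
  | hs c x hx => rw [mul_smul_aux, hx]
  | hp a b p =>
    rw [one_def, mul_def, map_sum, LinearMap.sum_apply, Finset.sum_eq_single b]
    · exact ofPath_comp p Quiver.Path.nil
    · exact fun c _ hc => ofPath_mul_of_ne _ _ hc.symm
    · exact fun h => absurd (Finset.mem_univ b) h

theorem mul_one_aux [Fintype V] (x : PathAlgebra k V) : x * 1 = x := by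
  induction x using PathAlgebra.induction with
  | h0 => exact zero_mul_aux 1
  | ha x x' hx hx' => rw [add_mul_aux, hx, hx']
  | hs c x hx => rw [smul_mul_aux, hx]
  | hp a b p =>
    rw [one_def, mul_def, map_sum, Finset.sum_eq_single a]
    · exact (ofPath_comp Quiver.Path.nil p).trans (by rw [Quiver.Path.nil_comp])
    · exact fun c _ hc => ofPath_mul_of_ne _ _ hc
    · exact fun h => absurd (Finset.mem_univ a) h

noncomputable instance [Fintype V] : Ring (PathAlgebra k V) :=
  { (inferInstance : AddCommGroup (PathAlgebra k V)) with
    mul := (· * ·)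
    one := 1
    left_distrib := mul_add_aux
    right_distrib := add_mul_aux
    zero_mul := zero_mul_aux
    mul_zero := mul_zero_aux
    mul_assoc := mul_assoc_aux
    one_mul := one_mul_aux
    mul_one := mul_one_aux }

noncomputable instance [Fintype V] : Algebra k (PathAlgebra k V) :=
  Algebra.ofModule smul_mul_aux fun c x y => mul_smul_aux c x y

variable (k V) in
/-- The arrow ideal `R` of the path algebra: the two-sided ideal generated by the arrows. -/
noncomputable def arrowIdeal [Fintype V] : Ideal (PathAlgebra k V) :=
  (TwoSidedIdeal.span {x : PathAlgebra k V |
    ∃ (a b : V) (f : a ⟶ b), x = ofPath k f.toPath}).asIdeal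

instance [Fintype V] : (arrowIdeal k V).IsTwoSided :=
  inferInstanceAs (TwoSidedIdeal.asIdeal _).IsTwoSided

/-- A two-sided ideal `I` of a path algebra is admissible if `R ^ m ≤ I ≤ R ^ 2` for some `m`. -/
def IsAdmissible [Fintype V] (I : Ideal (PathAlgebra k V)) : Prop :=
  I ≤ arrowIdeal k V ^ 2 ∧ ∃ m : ℕ, arrowIdeal k V ^ m ≤ I

end PathAlgebra

/-- A quiver is acyclic if it has no path of positive length from a vertex to itself. -/
def IsAcyclicQuiver (V : Type v) [Quiver.{w} V] : Prop :=
  ∀ (a : V) (p : Quiver.Path a a), p = Quiver.Path.nil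

/-- A `k`-algebra is directed if it is isomorphic to `k Q / I`, where `Q` is a finite acyclic
quiver and `I` is an admissible ideal. -/
def IsDirectedAlgebra (k : Type u) (A : Type v) [Field k] [Ring A] [Algebra k A] : Prop :=
  ∃ (V : Type) (_ : Fintype V) (_ : Quiver.{0} V) (_ : ∀ a b : V, Finite (a ⟶ b))
    (I : Ideal (PathAlgebra k V)) (_ : I.IsTwoSided),
    IsAcyclicQuiver V ∧ PathAlgebra.IsAdmissible I ∧ Nonempty (A ≃ₐ[k] (PathAlgebra k V ⧸ I))

end PathAlgebra

/-- A ring is self-injective if it is injective as a left module over itself. (For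
finite-dimensional algebras this is the same as injectivity of the right regular module.) -/
def IsSelfInjective (B : Type v) [Ring B] : Prop := Module.Injective B B

/-! ### The quivers and algebras of the examples -/

/-- The vertices `1` and `2` of the Kronecker quiver. -/
inductive Kronecker : Type
  | one
  | two
  deriving DecidableEq

namespace Kronecker

instance : Fintype Kronecker :=
  ⟨{one, two}, fun a => by cases a <;> simp⟩

/-- The arrows of the Kronecker quiver: two arrows from `1` to `2`. -/
inductive Arrow : Kronecker → Kronecker → Type
  | alpha : Arrow one two
  | beta : Arrow one two

instance : Quiver.{0} Kronecker := ⟨Arrow⟩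

end Kronecker

/-- The Kronecker algebra `Θ`, the path algebra of the Kronecker quiver. -/
abbrev KroneckerAlgebra (k : Type u) [Field k] := PathAlgebra k Kronecker

/-- The vertices of the uniformly oriented quiver `1 → 2 → ⋯ → m` of type `A`
(numbered from `0` to `m - 1`). -/
structure LinearQuiver (m : ℕ) where
  idx : Fin m

namespace LinearQuiver

/-- The vertices form a copy of `Fin m`. -/
def equivFin (m : ℕ) : LinearQuiver m ≃ Fin m := ⟨idx, mk, fun _ => rfl, fun _ => rfl⟩

instance (m : ℕ) : Fintype (LinearQuiver m) := Fintype.ofEquiv _ (equivFin m).symm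

/-- There is exactly one arrow from `i` to `i + 1`, and there are no other arrows. -/
instance (m : ℕ) : Quiver.{0} (LinearQuiver m) :=
  ⟨fun i j => PLift (i.idx.val + 1 = j.idx.val)⟩

end LinearQuiver

/-- The algebra `k A_m / R ^ n`, for `A_m` the uniformly oriented quiver `1 → 2 → ⋯ → m` and `R`
the arrow ideal of its path algebra. -/
abbrev TruncatedLinear (k : Type u) [Field k] (m n : ℕ) :=
  PathAlgebra k (LinearQuiver m) ⧸ PathAlgebra.arrowIdeal k (LinearQuiver m) ^ n

/-- The truncated polynomial algebra `k[x] / (x ^ n)`. -/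
abbrev TruncatedPolynomial (k : Type u) [Field k] (n : ℕ) :=
  k[X] ⧸ Ideal.span {(Polynomial.X : k[X]) ^ n}

end SepRel

namespace SepRel

/-! ### The tensor functor of a bimodule -/

namespace BalancedTensor

section Lift

variable {k : Type u} {A : Type v} [Field k] [Ring A]
  {M X : Type u} [AddCommGroup M] [Module k M] [Module Aᵐᵒᵖ M]
  [AddCommGroup X] [Module k X] [Module A X] {Z : Type x} [AddCommGroup Z] [Module k Z]

/-! Homologically, a directed algebra `A` has finite global dimension, whereas over a self-injective
algebra `B` a module of finite projective dimension is projective. If `N` is a left-right projective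
`B`-`A`-bimodule, then `N ⊗_A -` is exact and preserves projectives, so it sends every
finite-dimensional `A`-module to a projective `B`-module (`IsTriangular.projective`). The proof of
this avoids resolutions. It uses only idempotents triangular with respect to a partial order, and
induction on the support of the module: a projective cover at a minimal vertex has a kernel of
smaller support (`IsTriangular.exists_cover`), and the image of the resulting short exact sequence
splits by self-injectivity.

If the regular bimodule is a summand of a tensor product of two bimodules, every module is a retract
of its image under the composite tensor functor (`RegularIsSummand.projective`). When `A` and `B`
are separably related, that composite lands in projectives in either direction of division. Hence
all finite-dimensional modules over one of the two algebras are projective, and this algebra is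
semisimple.

The positive `J`-inequalities come from matrix representations over a commutative algebra `D`. A
summand is recognised by a central element sent to `1` by a bimodule map
(`RegularIsSummand.of_central`). For the Kronecker algebra the arrows act by `1` and by a generator
`x` of `D`, and rows are tensored with columns. For linear quivers each arrow acts by `x`, columns
tensored with rows behave as matrices, and a retraction reads off the coefficients of the correct
degree (`JLE.of_matrix`). -/

theorem tmul_balanced (m : M) (a : A) (y : X) : tmul k A (op a • m) y = tmul k A m (a • y) := by
  rw [tmul, tmul, ← sub_eq_zero, ← map_sub]
  exact (Submodule.Quotient.mk_eq_zero _).2 (Submodule.subset_span ⟨m, a, y, rfl⟩)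

/-- The linear map on `M ⊗_A X` induced by a balanced bilinear map. -/
noncomputable def lift (f : M →ₗ[k] X →ₗ[k] Z)
    (hf : ∀ (m : M) (a : A) (y : X), f (op a • m) y = f m (a • y)) :
    BalancedTensor k A M X →ₗ[k] Z :=
  (balancing k A M X).liftQ (TensorProduct.lift f) (by
    rw [balancing, Submodule.span_le]
    rintro _ ⟨m, a, y, rfl⟩
    simp [hf])

theorem lift_tmul (f : M →ₗ[k] X →ₗ[k] Z)
    (hf : ∀ (m : M) (a : A) (y : X), f (op a • m) y = f m (a • y)) (m : M) (y : X) :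
    lift f hf (tmul k A m y) = f m y := by
  simp [lift, tmul]

variable (k A X) in
/-- The map `m ↦ (y ↦ m ⊗ y)`. -/
noncomputable def mk : M →ₗ[k] X →ₗ[k] BalancedTensor k A M X :=
  LinearMap.mk₂ k (tmul k A) add_tmul smul_tmul tmul_add tmul_smul

@[simp]
theorem mk_apply (m : M) (y : X) : mk k A X m y = tmul k A m y := rfl

end Lift

attribute [local instance 50] BalancedTensor.leftModule

section Left

variable {k : Type u} {A : Type v} {B : Type w} [Field k] [Ring A] [Ring B]
  [Algebra k B] {M : Type u} [AddCommGroup M] [Module k M] [Module B M] [Module Aᵐᵒᵖ M]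
  [IsScalarTower k B M] [SMulCommClass B Aᵐᵒᵖ M]
  {X Y : Type u} [AddCommGroup X] [Module k X] [Module A X]
  [AddCommGroup Y] [Module k Y] [Module A Y]

theorem smul_tmul_left (b : B) (m : M) (y : X) :
    b • (tmul k A m y) = tmul k A (b • m) y := rfl

theorem isScalarTower_left : IsScalarTower k B (BalancedTensor k A M X) :=
  ⟨fun c b t => by
    induction t using BalancedTensor.induction with
    | h0 => simp only [smul_zero]
    | ht m n => exact (congrArg (tmul k A · n) (smul_assoc c b m)).trans (smul_tmul c _ n)
    | ha s t hs ht => simp only [smul_add, hs, ht]⟩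

attribute [local instance 50] isScalarTower_left

/-- A linear map on `M ⊗_A X` that commutes with the left action on elementary tensors. -/
def linearOfTmul {Z : Type x} [AddCommGroup Z] [Module k Z] [Module B Z]
    (f : BalancedTensor k A M X →ₗ[k] Z)
    (hf : ∀ (b : B) (m : M) (y : X), f (tmul k A (b • m) y) = b • f (tmul k A m y)) :
    BalancedTensor k A M X →ₗ[B] Z :=
  { f with
    map_smul' := fun b t => by
      change f (b • t) = b • f t
      induction t using BalancedTensor.induction with
      | h0 => simp
      | ht m n => exact hf b m n
      | ha s t hs ht => simp only [smul_add, map_add, hs, ht] }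

theorem linearOfTmul_apply {Z : Type x} [AddCommGroup Z] [Module k Z] [Module B Z]
    (f : BalancedTensor k A M X →ₗ[k] Z)
    (hf : ∀ (b : B) (m : M) (y : X), f (tmul k A (b • m) y) = b • f (tmul k A m y))
    (t : BalancedTensor k A M X) : linearOfTmul f hf t = f t := rfl

variable [Algebra k A] [IsScalarTower k A X] [IsScalarTower k A Y]

variable (k B M) in
/-- The map `M ⊗_A X → M ⊗_A Y` induced by a linear map `X → Y`. -/
noncomputable def mapRight (g : X →ₗ[A] Y) :
    BalancedTensor k A M X →ₗ[B] BalancedTensor k A M Y :=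
  linearOfTmul (lift ((mk k A Y).compl₂ (g.restrictScalars k)) (fun m a y => by
    simp [tmul_balanced])) (fun b m y => by
    simp [lift_tmul, smul_tmul_left])

@[simp]
theorem mapRight_tmul (g : X →ₗ[A] Y) (m : M) (y : X) :
    mapRight k B M g (tmul k A m y) = tmul k A m (g y) := by
  simp [mapRight, linearOfTmul_apply, lift_tmul]

theorem mapRight_surjective (g : X →ₗ[A] Y) (hg : Function.Surjective g) :
    Function.Surjective (mapRight k B M g) := fun t => by
  induction t using BalancedTensor.induction with
  | h0 => exact ⟨0, map_zero _⟩
  | ht m y =>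
    obtain ⟨z, rfl⟩ := hg y
    exact ⟨tmul k A m z, mapRight_tmul g m z⟩
  | ha s t hs ht =>
    obtain ⟨s, rfl⟩ := hs
    obtain ⟨t, rfl⟩ := ht
    exact ⟨s + t, map_add _ _ _⟩

/-- Tensoring with a finitely generated projective right module preserves injective maps. -/
theorem mapRight_injective [IsScalarTower k Aᵐᵒᵖ M] [Module.Finite k M] [Module.Projective Aᵐᵒᵖ M] (g : X →ₗ[A] Y)
    (hg : Function.Injective g) : Function.Injective (mapRight k B M g) := by
  have : Module.Finite Aᵐᵒᵖ M := Module.Finite.of_restrictScalars_finite k Aᵐᵒᵖ M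
  -- `M` is a retract of a free module of rank `n`: the images under `f` of the unit vectors and the
  -- components of `φ` form a dual basis.
  obtain ⟨n, f, φ, -, -, hfφ⟩ := Module.Finite.exists_comp_eq_id_of_projective Aᵐᵒᵖ M
  have hsum : ∀ m, ∑ i, φ m i • f (Pi.single i 1) = m := fun m => by
    conv_rhs => rw [← LinearMap.id_apply (R := Aᵐᵒᵖ) m, ← hfφ, LinearMap.comp_apply,
      ← LinearMap.sum_single_apply _ (φ m), map_sum]
    refine Finset.sum_congr rfl fun i _ => ?_
    rw [← map_smul]
    congr 1
    ext j
    by_cases h : j = i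
    · subst h; simp
    · simp [h]
  have hφk : ∀ (c : k) m i, φ (c • m) i = c • φ m i := fun c m i => by
    rw [LinearMap.map_smul_of_tower, Pi.smul_apply]
  -- The coordinates `m ⊗ z ↦ φ_i(m) z` are natural in `Z` and jointly injective, since a tensor is
  -- rebuilt from them. Injectivity of `g` therefore passes to the tensor products.
  let coord (Z : Type u) [AddCommGroup Z] [Module k Z] [Module A Z] [IsScalarTower k A Z]
      (i : Fin n) : BalancedTensor k A M Z →ₗ[k] Z :=
    lift (LinearMap.mk₂ k (fun m z => (φ m i).unop • z) (fun m m' z => by simp [add_smul])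
      (fun c m z => by rw [hφk, MulOpposite.unop_smul, smul_assoc])
      (fun m z z' => smul_add _ _ _) (fun c m z => smul_comm _ _ _)) (fun m a z => by
        simp [mul_smul])
  have coord_tmul (Z : Type u) [AddCommGroup Z] [Module k Z] [Module A Z] [IsScalarTower k A Z]
      (i : Fin n) (m : M) (z : Z) : coord Z i (tmul k A m z) = (φ m i).unop • z := lift_tmul _ _ _ _
  have hsymm : ∀ t : BalancedTensor k A M X,
      ∑ i, tmul k A (f (Pi.single i 1)) (coord X i t) = t := fun t => by
    induction t using BalancedTensor.induction with
    | h0 => simp [tmul_zero]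
    | ht m y =>
      conv_rhs => rw [← hsum m, ← mk_apply, map_sum, LinearMap.sum_apply]
      refine Finset.sum_congr rfl fun i _ => ?_
      rw [coord_tmul, ← tmul_balanced, mk_apply, MulOpposite.op_unop]
    | ha s t hs ht => simp only [map_add, tmul_add, Finset.sum_add_distrib, hs, ht]
  have hnat : ∀ i t, coord Y i (mapRight k B M g t) = g (coord X i t) := fun i t => by
    induction t using BalancedTensor.induction with
    | h0 => simp
    | ht m y => rw [mapRight_tmul, coord_tmul, coord_tmul, map_smul]
    | ha s t hs ht => simp only [map_add, hs, ht]
  intro s t hst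
  rw [← hsymm s, ← hsymm t]
  refine Finset.sum_congr rfl fun i _ => ?_
  rw [hg ((hnat i s).symm.trans ((congrArg _ hst).trans (hnat i t)))]

/-- `M ⊗_A X` is exact in the middle: the kernel of `M ⊗ g` is the image of `M ⊗ K`, for `g`
surjective with kernel `K`. -/
theorem mapRight_exact {K : Type u} [AddCommGroup K] [Module k K] [Module A K] [IsScalarTower k A K]
    (i : K →ₗ[A] X) (g : X →ₗ[A] Y) (hg : Function.Surjective g) (hi : Function.Exact i g) :
    Function.Exact (mapRight k B M i) (mapRight k B M g) := by
  let T := LinearMap.range (mapRight k B M i)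
  let Q := BalancedTensor k A M X ⧸ T.restrictScalars k
  let q : BalancedTensor k A M X →ₗ[k] Q := (T.restrictScalars k).mkQ
  have hq : ∀ m y y', g y = g y' → q (tmul k A m y) = q (tmul k A m y') := fun m y y' h => by
    rw [← sub_eq_zero, ← map_sub] at h
    obtain ⟨z, hz⟩ := (hi _).1 h
    refine (Submodule.Quotient.eq _).2 ⟨tmul k A m z, ?_⟩
    rw [mapRight_tmul, hz, sub_eq_add_neg, tmul_add, ← neg_one_smul k y', tmul_smul, neg_one_smul,
      sub_eq_add_neg]
  -- `σ` is only a set-theoretic section, but modulo the image of `M ⊗ K` the class of `m ⊗ y`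
  -- depends only on `g y`, so `m ⊗ y ↦ q (m ⊗ σ y)` is bilinear and balanced. The resulting `s`
  -- recovers `q` from `M ⊗ g`.
  let σ := Function.surjInv hg
  have hσ : ∀ y, g (σ y) = y := Function.surjInv_eq hg
  let s : BalancedTensor k A M Y →ₗ[k] Q :=
    lift (LinearMap.mk₂ k (fun m y => q (tmul k A m (σ y)))
      (fun m m' y => by rw [add_tmul, map_add])
      (fun c m y => by rw [smul_tmul, map_smul])
      (fun m y y' => by
        rw [← map_add, ← tmul_add]; exact hq _ _ _ (by simp [hσ]))
      (fun c m y => by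
        rw [← map_smul, ← tmul_smul]; exact hq _ _ _ (by
          rw [hσ, LinearMap.map_smul_of_tower, hσ])))
      (fun m a y => by
        change q _ = q _
        rw [tmul_balanced]; exact hq _ _ _ (by simp [hσ]))
  have hs : ∀ t, s (mapRight k B M g t) = q t := fun t => by
    induction t using BalancedTensor.induction with
    | h0 => simp
    | ht m y =>
      rw [mapRight_tmul]
      exact (lift_tmul _ _ _ _).trans (hq _ _ _ (by simp [hσ]))
    | ha s t hs ht => simp only [map_add, hs, ht]
  refine fun t => ⟨fun h => ?_, ?_⟩
  · have : q t = 0 := by rw [← hs, h, map_zero]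
    exact (Submodule.Quotient.mk_eq_zero _).1 this
  · rintro ⟨t, rfl⟩
    induction t using BalancedTensor.induction with
    | h0 => simp
    | ht m y => rw [mapRight_tmul, mapRight_tmul, hi.apply_apply_eq_zero, tmul_zero]
    | ha s t hs ht => simp only [map_add, hs, ht, add_zero]

/-- Tensoring with a left projective bimodule preserves finitely generated projective modules. -/
theorem projective_of_projective [IsScalarTower k Aᵐᵒᵖ M] [Module.Projective B M] [Module.Finite k X]
    [Module.Projective A X] : Module.Projective B (BalancedTensor k A M X) := by
  have : Module.Finite A X := Module.Finite.of_restrictScalars_finite k A X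
  obtain ⟨n, f, φ, -, -, hfφ⟩ := Module.Finite.exists_comp_eq_id_of_projective A X
  have hsum : ∀ y, ∑ i, φ y i • f (Pi.single i 1) = y := fun y => by
    conv_rhs => rw [← LinearMap.id_apply (R := A) y, ← hfφ, LinearMap.comp_apply,
      ← LinearMap.sum_single_apply _ (φ y), map_sum]
    refine Finset.sum_congr rfl fun i _ => ?_
    rw [← map_smul]
    congr 1
    ext j
    by_cases h : j = i
    · subst h; simp
    · simp [h]
  have hφk : ∀ (c : k) y i, φ (c • y) i = c • φ y i := fun c y i => by
    rw [LinearMap.map_smul_of_tower, Pi.smul_apply]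
  -- A dual basis of `X` exhibits `M ⊗_A X` as a retract of the projective left module `M ^ n`.
  let coord : BalancedTensor k A M X →ₗ[k] (Fin n → M) :=
    lift (LinearMap.mk₂ k (fun m y i => op (φ y i) • m)
      (fun m m' y => by ext i; simp)
      (fun c m y => by ext i; exact smul_comm _ _ _)
      (fun m y y' => by ext i; simp [add_smul])
      (fun c m y => by ext i; simp [hφk])) (fun m a y => by
        ext i; simp [mul_smul])
  have coord_tmul (m : M) (y : X) (i : Fin n) : coord (tmul k A m y) i = op (φ y i) • m :=
    congrFun (lift_tmul _ _ _ _) i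
  let back : (Fin n → M) →ₗ[B] BalancedTensor k A M X :=
    { toFun := fun m => ∑ i, tmul k A (m i) (f (Pi.single i 1))
      map_add' := fun m m' => by simp [add_tmul, Finset.sum_add_distrib]
      map_smul' := fun b m => by simp [Finset.smul_sum, smul_tmul_left] }
  have : Module.Projective B (Fin n → M) :=
    Module.Projective.of_equiv' (DirectSum.linearEquivFunOnFintype B (Fin n) fun _ => M)
  refine Module.Projective.of_split (linearOfTmul coord fun b m y => ?_) back ?_
  · ext i
    rw [coord_tmul, Pi.smul_apply, coord_tmul]
    exact (smul_comm b _ m).symm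
  · refine LinearMap.ext fun t => ?_
    change ∑ i, tmul k A (coord t i) (f (Pi.single i 1)) = t
    induction t using BalancedTensor.induction with
    | h0 => simp [zero_tmul]
    | ht m y =>
      conv_rhs => rw [← hsum y, ← mk_apply, map_sum]
      refine Finset.sum_congr rfl fun i _ => ?_
      rw [coord_tmul, tmul_balanced, mk_apply]
    | ha s t hs ht => simp only [map_add, Pi.add_apply, add_tmul, Finset.sum_add_distrib, hs, ht]

end Left

end BalancedTensor

/-! ### Self-injective rings, semisimple rings and small models of modules -/

/-- Over a self-injective ring, injective maps out of finitely generated projective modules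
split. -/
theorem IsSelfInjective.exists_leftInverse {B : Type w} [Ring B] (hB : IsSelfInjective B)
    {Q Y : Type*} [AddCommGroup Q] [Module B Q] [AddCommGroup Y] [Module B Y] [Module.Finite B Q]
    [Module.Projective B Q] (i : Q →ₗ[B] Y) (hi : Function.Injective i) :
    ∃ r : Y →ₗ[B] Q, r ∘ₗ i = LinearMap.id := by
  obtain ⟨n, f, φ, -, -, hfφ⟩ := Module.Finite.exists_comp_eq_id_of_projective B Q
  -- Each coordinate of `Q` in a free module extends along `i` by injectivity of `B`; applying `f`
  -- brings the extensions back to `Q`.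
  choose ψ hψ using fun j : Fin n => (Module.Baer.of_injective hB).extension_property i hi
    (LinearMap.proj j ∘ₗ φ)
  refine ⟨f ∘ₗ LinearMap.pi ψ, ?_⟩
  rw [LinearMap.comp_assoc, ← hfφ]
  congr 1
  refine LinearMap.ext fun y => funext fun j => ?_
  exact LinearMap.congr_fun (hψ j) y

/-- An element `z` of a semisimple ring with `z u z = 0` for all `u` is zero. -/
theorem eq_zero_of_isSemisimpleRing {A : Type v} [Ring A] [IsSemisimpleRing A] {z : A}
    (hz : ∀ y, z * y * z = 0) : z = 0 := by
  -- Write `1 = y z + l` along `A = A z ⊕ L`. Multiplying by `z` on the left gives `z = z l`, which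
  -- lies in both summands.
  obtain ⟨L, hL⟩ := exists_isCompl (Submodule.span A {z})
  obtain ⟨p, hp, l, hl, h⟩ := Submodule.mem_sup.1 (hL.sup_eq_top ▸ Submodule.mem_top : (1 : A) ∈ _)
  obtain ⟨y, rfl⟩ := Submodule.mem_span_singleton.1 hp
  have hzl : z = z * l := by
    conv_lhs => rw [← mul_one z, ← h, mul_add, smul_eq_mul, ← mul_assoc, hz, zero_add]
  exact (Submodule.disjoint_def.1 hL.disjoint) z (Submodule.mem_span_singleton_self z)
    (hzl ▸ L.smul_mem z hl)

/-- Coordinates in a basis embed `P` into a power of `k`. This permits moving finite-dimensional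
modules into the universe of `k`, where the tensor functors are defined. -/
theorem small_of_finite (k : Type u) [Field k] (P : Type v) [AddCommGroup P] [Module k P]
    [Module.Finite k P] : Small.{u} P :=
  small_of_injective (Module.finBasis k P).equivFun.injective

theorem isScalarTower_shrink (k : Type u) [Field k] (A : Type w) [Ring A] [Algebra k A]
    (P : Type v) [AddCommGroup P] [Module k P] [Module A P] [IsScalarTower k A P] [Small.{u} P] :
    IsScalarTower k A (Shrink.{u} P) :=
  ⟨fun c a p => (equivShrink P).symm.injective (by simp [equivShrink_symm_smul])⟩

/-- An algebra is semisimple if all of its finite-dimensional modules are projective. -/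
theorem isSemisimpleRing_of_projective (k : Type u) [Field k] {A : Type v} [Ring A] [Algebra k A]
    [Module.Finite k A]
    (h : ∀ (Y : Type u) [AddCommGroup Y] [Module k Y] [Module A Y] [IsScalarTower k A Y]
      [Module.Finite k Y], Module.Projective A Y) : IsSemisimpleRing A := by
  refine (isSemisimpleModule_iff A A).2 ⟨fun I => ?_⟩
  have : Small.{u} (A ⧸ I) := small_of_finite k _
  have := isScalarTower_shrink k A (A ⧸ I)
  have : Module.Finite k (Shrink.{u} (A ⧸ I)) :=
    Module.Finite.equiv (Shrink.linearEquiv k (A ⧸ I)).symm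
  have := h (Shrink.{u} (A ⧸ I))
  have : Module.Projective A (A ⧸ I) := Module.Projective.of_shrink
  -- A section of `A → A ⧸ I` turns `a ↦ a - s [a]` into a projection of `A` onto `I`, so `I` has a
  -- complement.
  obtain ⟨s, hs⟩ := Module.projective_lifting_property I.mkQ LinearMap.id I.mkQ_surjective
  have hs' : ∀ y, I.mkQ (s y) = y := LinearMap.congr_fun hs
  refine ⟨_, LinearMap.isCompl_of_proj (f := LinearMap.codRestrict I
    (LinearMap.id - s ∘ₗ I.mkQ) fun a => ?_) fun a => Subtype.ext ?_⟩
  · rw [← Submodule.Quotient.mk_eq_zero, ← Submodule.mkQ_apply]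
    simp only [LinearMap.sub_apply, map_sub, LinearMap.comp_apply, hs', LinearMap.id_apply, sub_self]
  · have : I.mkQ a = 0 := (Submodule.Quotient.mk_eq_zero I).2 a.2
    simp only [LinearMap.codRestrict_apply, LinearMap.sub_apply, LinearMap.comp_apply, this,
      map_zero, sub_zero, LinearMap.id_apply]

/-! ### Modules are retracts of their images under separable division -/

section Retract

attribute [local instance 50] BalancedTensor.leftModule BalancedTensor.rightModule
  BalancedTensor.isScalarTower_left

variable {k : Type u} {A : Type v} {B : Type w} [Field k] [Ring A] [Algebra k A] [Ring B]
  [Algebra k B] {M : Bimodule k A B} {N : Bimodule k B A}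

/-- A bimodule map out of `A` is determined by the image of `1`, which commutes with the action of
`A`. Thus the inclusion of the summand becomes the element `t`, and `π` is the projection onto it.
-/
theorem RegularIsSummand.exists_central (h : RegularIsSummand (M.tensor N)) :
    ∃ (t : BalancedTensor k B M.carrier N.carrier)
      (π : BalancedTensor k B M.carrier N.carrier →ₗ[k] A), π t = 1 ∧
      (∀ a : A, a • t = op a • t) ∧
      (∀ (a : A) (m : M.carrier) (n : N.carrier),
        π (tmul k B (a • m) n) = a * π (tmul k B m n)) ∧
      (∀ (a : A) (m : M.carrier) (n : N.carrier),
        π (tmul k B m (op a • n)) = π (tmul k B m n) * a) := by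
  obtain ⟨Z, e, hl, hr⟩ := h
  have hl' : ∀ (a : A) (t : BalancedTensor k B M.carrier N.carrier), e (a • t) = a • e t := hl
  have hr' : ∀ (a : A) (t : BalancedTensor k B M.carrier N.carrier), e (op a • t) = op a • e t := hr
  let π : BalancedTensor k B M.carrier N.carrier →ₗ[k] A :=
    { toFun := fun t => (e t).1
      map_add' := fun s t => congrArg Prod.fst (map_add e s t)
      map_smul' := fun c t => by
        -- The isomorphism `e` is only additive and `A`-linear on both sides; its `k`-linearity
        -- comes from scalars acting through `A`.
        have : c • t = (c • (1 : A)) • t := by rw [smul_assoc, one_smul]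
        rw [this, hl', Prod.smul_fst, smul_assoc, one_smul]
        rfl }
  refine ⟨e.symm (1, 0), π, ?_, fun a => ?_, fun a m n => ?_, fun a m n => ?_⟩
  · exact congrArg Prod.fst (e.apply_symm_apply _)
  · apply e.injective
    refine (hl _ _).trans (Eq.trans ?_ (hr _ _).symm)
    rw [e.apply_symm_apply]
    ext <;> simp
  · exact congrArg Prod.fst (hl' a (tmul k B m n))
  · exact congrArg Prod.fst (hr' a (tmul k B m n))

open BalancedTensor in
/-- If the regular bimodule is a summand of `M ⊗_B N`, then any module `Y` is a retract of
`M ⊗_B (N ⊗_A Y)`. -/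
theorem RegularIsSummand.projective (h : RegularIsSummand (M.tensor N)) (Y : Type u)
    [AddCommGroup Y] [Module k Y] [Module A Y] [IsScalarTower k A Y]
    [Module.Projective A
      (BalancedTensor k B M.carrier (BalancedTensor k A N.carrier Y))] :
    Module.Projective A Y := by
  obtain ⟨t, π, ht, hc, hl, hr⟩ := h.exists_central
  -- The map `m ⊗ n ↦ m ⊗ (n ⊗ y)`. Its value at `t` embeds `Y` linearly in `y`, because `t` is
  -- central: `ev (a y) t = ev y (t a) = ev y (a t) = a ev y t`.
  let ev (y : Y) : BalancedTensor k B M.carrier N.carrier →ₗ[k]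
      BalancedTensor k B M.carrier (BalancedTensor k A N.carrier Y) :=
    lift ((BalancedTensor.mk k B _).compl₂ ((BalancedTensor.mk k A Y).flip y)) (fun m b n => by
      simp only [LinearMap.compl₂_apply, mk_apply, LinearMap.flip_apply, tmul_balanced,
        smul_tmul_left])
  have ev_tmul : ∀ y m n, ev y (tmul k B m n) = tmul k B m (tmul k A n y) :=
    fun y m n => lift_tmul _ _ _ _
  have ev_add : ∀ y y' s, ev (y + y') s = ev y s + ev y' s := fun y y' s => by
    induction s using BalancedTensor.induction with
    | h0 => simp
    | ht m n => simp only [ev_tmul, tmul_add]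
    | ha s s' hs hs' => simp only [map_add, hs, hs']; abel
  have ev_left : ∀ y (a : A) s, ev y (a • s) = a • ev y s := fun y a s => by
    induction s using BalancedTensor.induction with
    | h0 => simp
    | ht m n => exact ev_tmul _ _ _
    | ha s s' hs hs' => simp only [map_add, smul_add, hs, hs']
  have ev_right : ∀ y (a : A) s, ev y (op a • s) = ev (a • y) s := fun y a s => by
    induction s using BalancedTensor.induction with
    | h0 => simp
    | ht m n =>
      rw [ev_tmul, ← tmul_balanced]
      exact ev_tmul _ _ _
    | ha s s' hs hs' => simp only [map_add, smul_add, hs, hs']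
  let act (m : M.carrier) : BalancedTensor k A N.carrier Y →ₗ[k] Y :=
    lift (LinearMap.mk₂ k (fun n y => π (tmul k B m n) • y)
      (fun n n' y => by rw [tmul_add, map_add, add_smul])
      (fun c n y => by rw [tmul_smul, map_smul, smul_assoc])
      (fun n y y' => smul_add _ _ _) (fun c n y => smul_comm _ _ _))
      (fun n a y => by
        rw [LinearMap.mk₂_apply, LinearMap.mk₂_apply, hr, mul_smul])
  have act_tmul : ∀ m n y, act m (tmul k A n y) = π (tmul k B m n) • y :=
    fun m n y => lift_tmul _ _ _ _
  -- The retraction `m ⊗ (n ⊗ y) ↦ π(m ⊗ n) y`; composed with the embedding it is multiplication by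
  -- `π t = 1`.
  let back : BalancedTensor k B M.carrier (BalancedTensor k A N.carrier Y) →ₗ[k] Y :=
    lift (LinearMap.mk₂ k (fun m s => act m s)
      (fun m m' s => by
        induction s using BalancedTensor.induction with
        | h0 => simp
        | ht n y => simp only [act_tmul, add_tmul, map_add, add_smul]
        | ha s s' hs hs' => simp only [map_add, hs, hs']; abel)
      (fun c m s => by
        induction s using BalancedTensor.induction with
        | h0 => simp
        | ht n y => rw [act_tmul, act_tmul, smul_tmul, map_smul, smul_assoc]
        | ha s s' hs hs' => simp only [map_add, hs, hs', smul_add])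
      (fun m s s' => map_add _ _ _) (fun c m s => map_smul _ _ _))
      (fun m b s => by
        rw [LinearMap.mk₂_apply, LinearMap.mk₂_apply]
        induction s using BalancedTensor.induction with
        | h0 => simp
        | ht n y => rw [act_tmul, smul_tmul_left, act_tmul, tmul_balanced]
        | ha s s' hs hs' => simp only [map_add, hs, hs', smul_add])
  have back_tmul : ∀ m s, back (tmul k B m s) = act m s := fun m s => lift_tmul _ _ _ _
  have back_ev : ∀ y s, back (ev y s) = π s • y := fun y s => by
    induction s using BalancedTensor.induction with
    | h0 => simp
    | ht m n => rw [ev_tmul, back_tmul, act_tmul]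
    | ha s s' hs hs' => simp only [map_add, hs, hs', add_smul]
  refine Module.Projective.of_split
    (M := BalancedTensor k B M.carrier (BalancedTensor k A N.carrier Y))
    { toFun := fun y => ev y t, map_add' := fun y y' => ev_add y y' t, map_smul' := fun a y => ?_ }
    (linearOfTmul back fun a m s => ?_) (LinearMap.ext fun y => ?_)
  · rw [RingHom.id_apply, ← ev_right, ← hc, ev_left]
  · rw [back_tmul, back_tmul]
    induction s using BalancedTensor.induction with
    | h0 => simp
    | ht n y => rw [act_tmul, act_tmul, hl, mul_smul]
    | ha s s' hs hs' => simp only [map_add, smul_add, hs, hs']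
  · exact (back_ev y t).trans (by rw [ht, one_smul]; rfl)

end Retract

/-! ### Algebras with a triangular system of idempotents -/

/-- A complete family of orthogonal idempotents, indexed by a partially ordered set, such that
`e b A e a = 0` unless `a ≤ b`, and `e a A e a` is spanned by `e a`. -/
structure IsTriangular (k : Type u) {A : Type v} [Field k] [Ring A] [Algebra k A] {V : Type*}
    [Fintype V] [PartialOrder V] (e : V → A) : Prop extends CompleteOrthogonalIdempotents e where
  mul_mul_eq_zero : ∀ a b y, ¬ a ≤ b → e b * y * e a = 0
  exists_smul : ∀ a y, ∃ c : k, e a * y * e a = c • e a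

section Triangular

variable {k : Type u} {A : Type v} [Field k] [Ring A] [Algebra k A] {V : Type*}
    [Fintype V] [PartialOrder V] {e : V → A}

/-- Take `P = ⨁ A e_a ⊗ e_a X`, mapped to `X` by the action. The part `e_c A e_a ⊗ e_a X` vanishes
unless `a ∈ U` and `a ≤ c`, so `P` is supported on the up-set `U`. At the minimal vertex `b` only `k
e_b ⊗ e_b X` survives, and it maps injectively to `X`. The kernel has thus lost the vertex `b`. -/
theorem IsTriangular.exists_cover [Module.Finite k A] (he : IsTriangular k e) (X : Type u)
    [AddCommGroup X] [Module k X] [Module A X] [IsScalarTower k A X] [Module.Finite k X]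
    {U : Finset V} (hU : ∀ a ∈ U, ∀ b, a ≤ b → b ∈ U) (hX : ∀ a ∉ U, ∀ y : X, e a • y = 0)
    {b : V} (hb : Minimal (· ∈ U) b) :
    ∃ (P : Type u) (_ : AddCommGroup P) (_ : Module k P) (_ : Module A P) (_ : IsScalarTower k A P)
      (_ : Module.Finite k P) (_ : Module.Projective A P) (π : P →ₗ[A] X),
      Function.Surjective π ∧ ∀ z, π z = 0 → ∀ c, c ∉ U ∨ c = b → e c • z = 0 := by
  classical
  -- The idempotent endomorphism of the free module `A ⊗ X` whose image is `⨁ A e_a ⊗ e_a X`, which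
  -- is therefore projective.
  let E : A ⊗[k] X →ₗ[A] A ⊗[k] X := ∑ a, TensorProduct.AlgebraTensorModule.map
    (LinearMap.toSpanSingleton A A (e a)) (Algebra.lsmul k k X (e a))
  have hE : ∀ y x, E (y ⊗ₜ x) = ∑ a, (y * e a) ⊗ₜ (e a • x) := fun y x => by
    simp [E, LinearMap.sum_apply]
  have hEE : ∀ z, E (E z) = E z := fun z => by
    induction z with
    | zero => simp
    | add z z' hz hz' => simp [hz, hz']
    | tmul y x =>
      rw [hE, map_sum]
      refine Finset.sum_congr rfl fun a _ => ?_
      rw [hE, Finset.sum_eq_single a]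
      · rw [mul_assoc, ← mul_smul, (he.idem a).eq]
      · intro c _ hc
        rw [mul_assoc, he.ortho hc.symm, mul_zero, TensorProduct.zero_tmul]
      · simp
  let μ : A ⊗[k] X →ₗ[A] X := TensorProduct.AlgebraTensorModule.lift
    { toFun := fun y => Algebra.lsmul k k X y
      map_add' := fun y y' => map_add _ _ _
      map_smul' := fun y y' => by ext x; simp }
  have hμ : ∀ y x, μ (y ⊗ₜ x) = y • x := fun y x => rfl
  have hμE : ∀ z, μ (E z) = μ z := fun z => by
    induction z with
    | zero => simp
    | add z z' hz hz' => simp [hz, hz']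
    | tmul y x =>
      rw [hE, map_sum, hμ]
      simp_rw [hμ, ← mul_smul, mul_assoc, (he.idem _).eq]
      rw [← Finset.sum_smul, ← Finset.mul_sum, he.complete, mul_one]
  have hout : ∀ c ∉ U, ∀ z, e c • E z = 0 := fun c hc z => by
    induction z with
    | zero => simp
    | add z z' hz hz' => simp [hz, hz']
    | tmul y x =>
      rw [hE, Finset.smul_sum]
      refine Finset.sum_eq_zero fun a _ => ?_
      rw [TensorProduct.smul_tmul', smul_eq_mul, ← mul_assoc]
      by_cases ha : a ∈ U
      · rw [he.mul_mul_eq_zero a c y fun h => hc (hU a ha c h), TensorProduct.zero_tmul]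
      · rw [hX a ha, TensorProduct.tmul_zero]
  -- As `e_b A e_b = k e_b`, the left factor at `b` is a scalar that moves across the tensor sign.
  -- So an element of the image of `E` is determined at `b` by its image under `μ`.
  have hmin : ∀ z, e b • E z = e b ⊗ₜ μ (e b • E z) := fun z => by
    induction z with
    | zero => simp
    | add z z' hz hz' => simp only [map_add, smul_add, TensorProduct.tmul_add, ← hz, ← hz']
    | tmul y x =>
      have h : e b • E (y ⊗ₜ x) = (e b * y * e b) ⊗ₜ[k] (e b • x) := by
        rw [hE, Finset.smul_sum, Finset.sum_eq_single b]
        · rw [TensorProduct.smul_tmul', smul_eq_mul, ← mul_assoc]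
        · intro a _ ha
          rw [TensorProduct.smul_tmul', smul_eq_mul, ← mul_assoc]
          by_cases haU : a ∈ U
          · rw [he.mul_mul_eq_zero a b y fun h => ha (h.antisymm (hb.2 haU h)),
              TensorProduct.zero_tmul]
          · rw [hX a haU, TensorProduct.tmul_zero]
        · simp
      obtain ⟨c, hc⟩ := he.exists_smul b y
      rw [h, hμ, hc, smul_assoc, ← mul_smul, (he.idem b).eq, TensorProduct.smul_tmul]
  let P₀ := LinearMap.range E
  have hP₀ : ∀ z ∈ P₀, E z = z := by
    rintro _ ⟨z, rfl⟩
    exact hEE z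
  have : Module.Projective A P₀ := Module.Projective.of_split P₀.subtype E.rangeRestrict
    (LinearMap.ext fun z => Subtype.ext (hP₀ z z.2))
  have : Module.Finite k P₀ :=
    inferInstanceAs (Module.Finite k (P₀.restrictScalars k))
  have : Small.{u} P₀ := small_of_finite k _
  let i := Shrink.linearEquiv.{u} A P₀
  refine ⟨Shrink.{u} P₀, inferInstance, inferInstance, inferInstance, isScalarTower_shrink k A P₀,
    Module.Finite.equiv (Shrink.linearEquiv.{u} k P₀).symm, inferInstance,
    μ ∘ₗ P₀.subtype ∘ₗ i.toLinearMap, fun x => ?_, fun z hz c hc => ?_⟩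
  · refine ⟨i.symm ⟨E (1 ⊗ₜ x), ⟨_, rfl⟩⟩, ?_⟩
    simp [hμE, hμ]
  · apply i.injective
    apply Subtype.ext
    rw [map_smul, map_zero, Submodule.coe_smul, Submodule.coe_zero, ← hP₀ _ (i z).2]
    obtain hc | rfl := hc
    · exact hout c hc _
    · rw [hmin, hP₀ _ (i z).2, map_smul]
      have : μ (i z : A ⊗[k] X) = 0 := hz
      rw [this, smul_zero, TensorProduct.tmul_zero]

attribute [local instance 50] BalancedTensor.leftModule BalancedTensor.isScalarTower_left

open BalancedTensor in
/-- A left-right projective bimodule over a self-injective algebra and a triangular algebra sends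
every module to a projective module. -/
theorem IsTriangular.projective [Module.Finite k A] (he : IsTriangular k e) {B : Type w} [Ring B]
    [Algebra k B] (hB : IsSelfInjective B) (N : Bimodule k B A) (hN : N.IsLeftRightProjective)
    (X : Type u) [AddCommGroup X] [Module k X] [Module A X] [IsScalarTower k A X]
    [Module.Finite k X] : Module.Projective B (BalancedTensor k A N.carrier X) := by
  classical
  have := hN.1
  have := hN.2
  -- Induction on the size of an up-set supporting the module; the module must vary, since the step
  -- passes to a kernel.
  suffices H : ∀ (n : ℕ) (U : Finset V), U.card = n → (∀ a ∈ U, ∀ b, a ≤ b → b ∈ U) →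
      ∀ (X : Type u) [AddCommGroup X] [Module k X] [Module A X] [IsScalarTower k A X]
        [Module.Finite k X], (∀ a ∉ U, ∀ y : X, e a • y = 0) →
        Module.Projective B (BalancedTensor k A N.carrier X) from
    H _ Finset.univ rfl (fun _ _ b _ => Finset.mem_univ b) X
      fun a ha => absurd (Finset.mem_univ a) ha
  intro n
  induction n with
  | zero =>
    intro U hU _ X _ _ _ _ _ hX
    obtain rfl := Finset.card_eq_zero.1 hU
    have : Subsingleton X := subsingleton_of_forall_eq 0 fun y => by
      rw [← one_smul A y, ← he.complete, Finset.sum_smul]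
      exact Finset.sum_eq_zero fun a _ => hX a (Finset.notMem_empty a) y
    exact projective_of_projective
  | succ n ih =>
    intro U hUn hU X _ _ _ _ _ hX
    obtain ⟨b, hb⟩ := Finset.exists_minimal (s := U)
      (Finset.card_pos.1 (hUn ▸ Nat.succ_pos n))
    obtain ⟨P, _, _, _, _, _, _, π, hπ, hK⟩ := he.exists_cover X hU hX hb
    let K := LinearMap.ker π
    have : Module.Finite k K := inferInstanceAs (Module.Finite k (K.restrictScalars k))
    have hFK : Module.Projective B (BalancedTensor k A N.carrier K) := by
      refine ih (U.erase b) (by rw [Finset.card_erase_of_mem hb.1, hUn]; rfl) ?_ K ?_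
      · intro a ha c hac
        rw [Finset.mem_erase] at ha ⊢
        refine ⟨?_, hU a ha.2 c hac⟩
        rintro rfl
        exact ha.1 (le_antisymm hac (hb.2 ha.2 hac))
      · intro a ha z
        refine Subtype.ext (hK z z.2 a ?_)
        rw [Finset.mem_erase] at ha
        tauto
    have : Module.Finite B (BalancedTensor k A N.carrier K) :=
      Module.Finite.of_restrictScalars_finite k B _
    have hex : Function.Exact (mapRight k B N.carrier K.subtype) (mapRight k B N.carrier π) :=
      mapRight_exact _ _ hπ (LinearMap.exact_subtype_ker_map π)
    have hP : Module.Projective B (BalancedTensor k A N.carrier P) := projective_of_projective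
    -- `N ⊗ K` is finitely generated projective, so over the self-injective `B` the inclusion into
    -- `N ⊗ P` splits and `N ⊗ X` is a summand of the projective `N ⊗ P`.
    obtain ⟨-, s, hs⟩ := (hex.split_tfae'.out 0 1 rfl rfl).2 ⟨mapRight_surjective _ hπ,
      hB.exists_leftInverse _ (mapRight_injective _ K.subtype_injective)⟩
    exact Module.Projective.of_split s _ hs

/-- Whichever algebra divides the other, the composite tensor functor passes through
`IsTriangular.projective`, so each of its values is projective. Retracts of these are all the
finite-dimensional modules over the dividing algebra. -/
theorem IsTriangular.not_separablyRelated [Module.Finite k A] (he : IsTriangular k e)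
    {B : Type w} [Ring B] [Algebra k B] [Module.Finite k B] (hB : IsSelfInjective B)
    (hA : ¬ IsSemisimpleRing A) (hB' : ¬ IsSemisimpleRing B) : ¬ SeparablyRelated k A B := by
  rintro (⟨M, N, hM, hN, h⟩ | ⟨M, N, hM, hN, h⟩)
  · refine hA (isSemisimpleRing_of_projective k fun Y _ _ _ _ _ => ?_)
    have := hM.1
    have := he.projective hB N hN Y
    have := BalancedTensor.projective_of_projective (k := k) (A := B) (B := A) (M := M.carrier)
      (X := BalancedTensor k A N.carrier Y)
    exact h.projective Y
  -- Here `M` is the `B`-`A`-bimodule and is applied last, so `M ⊗_A (N ⊗_B Y)` is already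
  -- projective over `B`.
  · refine hB' (isSemisimpleRing_of_projective k fun Y _ _ _ _ _ => ?_)
    have := he.projective hB M hM (BalancedTensor k B N.carrier Y)
    exact h.projective Y

end Triangular

/-! ### Path algebras of acyclic quivers are triangular -/

section Directed

theorem IsTriangular.map {k : Type u} {A : Type v} {B : Type w} [Field k] [Ring A] [Algebra k A]
    [Ring B] [Algebra k B] {V : Type*} [Fintype V] [PartialOrder V] {e : V → A}
    (he : IsTriangular k e) (f : A →ₐ[k] B) (hf : Function.Surjective f) :
    IsTriangular k (f ∘ e) where
  idem a := (he.idem a).map f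
  ortho a b h := by simp [← map_mul, he.ortho h]
  complete := by simp [← map_sum, he.complete]
  mul_mul_eq_zero a b y h := by
    obtain ⟨y, rfl⟩ := hf y
    simp [← map_mul, he.mul_mul_eq_zero a b y h]
  exists_smul a y := by
    obtain ⟨y, rfl⟩ := hf y
    obtain ⟨c, hc⟩ := he.exists_smul a y
    exact ⟨c, by simp [← map_mul, hc]⟩

/-- The vertices of an acyclic quiver, ordered by the existence of paths. -/
abbrev IsAcyclicQuiver.partialOrder {V : Type v} [Quiver.{w} V] (hV : IsAcyclicQuiver V) :
    PartialOrder V where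
  le a b := Nonempty (Quiver.Path a b)
  le_refl a := ⟨Quiver.Path.nil⟩
  le_trans _ _ _ := fun ⟨p⟩ ⟨q⟩ => ⟨p.comp q⟩
  le_antisymm a b := fun ⟨p⟩ ⟨q⟩ => by
    have h := congrArg Quiver.Path.length (hV a (p.comp q))
    rw [Quiver.Path.length_comp, Quiver.Path.length_nil, Nat.add_eq_zero_iff] at h
    exact p.eq_of_length_zero h.1

variable (k : Type u) [Field k] {V : Type v} [Fintype V] [Quiver.{w} V]

/-- A nonzero term would need a path from `b` to `c` in the middle. Besides triangularity, this
gives `z y z = 0` for an arrow `z` with no path back, the obstruction to semisimplicity. -/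
theorem PathAlgebra.ofPath_mul_mul_ofPath {a b c d : V} (p : Quiver.Path a b)
    (q : Quiver.Path c d) (h : IsEmpty (Quiver.Path b c)) (y : PathAlgebra k V) :
    ofPath k q * y * ofPath k p = 0 := by
  induction y using PathAlgebra.induction with
  | h0 => simp
  | ha y y' hy hy' => rw [mul_add, add_mul, hy, hy', add_zero]
  | hs c y hy => rw [mul_smul_comm, smul_mul_assoc, hy, smul_zero]
  | hp a' b' r =>
    by_cases h₁ : b' = c
    · subst h₁
      by_cases h₂ : b = a'
      · subst h₂
        exact (h.false r).elim
      · rw [mul_assoc, ofPath_mul_of_ne _ _ h₂, mul_zero]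
    · rw [ofPath_mul_of_ne _ _ h₁, zero_mul]

open PathAlgebra in
-- Acyclicity leaves only the trivial path from a vertex to itself, so each diagonal corner is
-- one-dimensional; the off-diagonal vanishing is the path order itself.
theorem IsAcyclicQuiver.isTriangular (hV : IsAcyclicQuiver V) :
    letI := hV.partialOrder
    IsTriangular k fun a : V => ofPath k (Quiver.Path.nil : Quiver.Path a a) :=
  letI := hV.partialOrder
  { idem := fun a => ofPath_comp _ _
    ortho := fun a b h => ofPath_mul_of_ne _ _ h.symm
    complete := (one_def (k := k)).symm
    mul_mul_eq_zero := fun a b y h => ofPath_mul_mul_ofPath k _ _ (not_nonempty_iff.1 h) y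
    exists_smul := fun a y => by
      induction y using PathAlgebra.induction with
      | h0 => exact ⟨0, by simp⟩
      | ha y y' hy hy' =>
        obtain ⟨c, hc⟩ := hy
        obtain ⟨c', hc'⟩ := hy'
        exact ⟨c + c', by rw [mul_add, add_mul, hc, hc', add_smul]⟩
      | hs d y hy =>
        obtain ⟨c, hc⟩ := hy
        exact ⟨d * c, by rw [mul_smul_comm, smul_mul_assoc, hc, mul_smul]⟩
      | hp b c p =>
        by_cases h₁ : c = a
        · subst h₁
          by_cases h₂ : c = b
          · subst h₂
            refine ⟨1, ?_⟩
            rw [hV _ p, ofPath_comp, ofPath_comp, one_smul]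
            rfl
          · exact ⟨0, by rw [mul_assoc, ofPath_mul_of_ne _ _ h₂, mul_zero, zero_smul]⟩
        · exact ⟨0, by rw [ofPath_mul_of_ne _ _ h₁, zero_mul, zero_smul]⟩ }

theorem IsDirectedAlgebra.not_separablyRelated {k : Type u} [Field k] {A : Type v} {B : Type w}
    [Ring A] [Algebra k A] [Module.Finite k A] [Ring B] [Algebra k B] [Module.Finite k B]
    (hA : IsDirectedAlgebra k A) (hB : IsSelfInjective B)
    (hA' : ¬ IsSemisimpleRing A) (hB' : ¬ IsSemisimpleRing B) : ¬ SeparablyRelated k A B := by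
  obtain ⟨V, _, _, -, I, _, hV, -, ⟨φ⟩⟩ := hA
  let := hV.partialOrder
  exact ((hV.isTriangular k).map (φ.symm.toAlgHom.comp (Ideal.Quotient.mkₐ k I))
    (φ.symm.surjective.comp (Ideal.Quotient.mkₐ_surjective k I))).not_separablyRelated hB hA' hB'

end Directed

/-! ### Powers of the arrow ideal and matrix representations of path algebras -/

namespace PathAlgebra

section Arrow

variable (k : Type u) [Field k] (V : Type v) [Fintype V] [Quiver.{w} V]

/-- The ideal of the path algebra generated by the paths of length at least `n`. -/
noncomputable def longPaths (n : ℕ) : Ideal (PathAlgebra k V) :=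
  Ideal.span {y | ∃ (a b : V) (p : Quiver.Path a b), n ≤ p.length ∧ y = ofPath k p}

variable {k V}

theorem ofPath_mem_longPaths {n : ℕ} {a b : V} (p : Quiver.Path a b) (hp : n ≤ p.length) :
    ofPath k p ∈ longPaths k V n :=
  Ideal.subset_span ⟨a, b, p, hp, rfl⟩

theorem ofPath_mul_ofPath_mem_longPaths {n : ℕ} {a b c d : V} (p : Quiver.Path a b)
    (q : Quiver.Path c d) (h : n ≤ q.length + p.length) :
    ofPath k q * ofPath k p ∈ longPaths k V n := by
  by_cases hbc : b = c
  · subst hbc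
    rw [ofPath_comp]
    exact ofPath_mem_longPaths _ (by rw [Quiver.Path.length_comp]; omega)
  · rw [ofPath_mul_of_ne _ _ hbc]
    exact zero_mem _

theorem smul_mem_longPaths {n : ℕ} (c : k) {y : PathAlgebra k V} (hy : y ∈ longPaths k V n) :
    c • y ∈ longPaths k V n := by
  rw [← smul_one_mul]
  exact Ideal.mul_mem_left _ _ hy

instance (n : ℕ) : (longPaths k V n).IsTwoSided := ⟨fun {y} z hy => by
  induction hy using Submodule.span_induction with
  | zero => simp
  | add y y' _ _ hy hy' => rw [add_mul]; exact add_mem hy hy'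
  | smul c y _ hy => rw [smul_mul_assoc]; exact Submodule.smul_mem _ _ hy
  | mem y hy =>
    obtain ⟨a, b, p, hp, rfl⟩ := hy
    induction z using PathAlgebra.induction with
    | h0 => simp
    | ha z z' hz hz' => rw [mul_add]; exact add_mem hz hz'
    | hs c z hz => rw [mul_smul_comm]; exact smul_mem_longPaths c hz
    | hp a b q => exact ofPath_mul_ofPath_mem_longPaths q p (by omega)⟩

theorem longPaths_mul_le (m n : ℕ) :
    longPaths k V m * longPaths k V n ≤ longPaths k V (m + n) := by
  refine Ideal.mul_le.2 fun y hy z hz => ?_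
  induction hz using Submodule.span_induction generalizing y with
  | zero => simp
  | add z z' _ _ hz hz' => rw [mul_add]; exact add_mem (hz y hy) (hz' y hy)
  | smul c z _ hz =>
    -- The coefficient `c` is absorbed into `y`, which uses that the ideal is two-sided and that `y`
    -- was kept arbitrary.
    rw [smul_eq_mul, ← mul_assoc]
    exact hz _ (Ideal.mul_mem_right _ _ hy)
  | mem z hz =>
    obtain ⟨a, b, p, hp, rfl⟩ := hz
    induction hy using Submodule.span_induction with
    | zero => simp
    | add y y' _ _ hy hy' => rw [add_mul]; exact add_mem hy hy'
    | smul c y _ hy => rw [smul_mul_assoc]; exact Submodule.smul_mem _ _ hy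
    | mem y hy =>
      obtain ⟨c, d, q, hq, rfl⟩ := hy
      exact ofPath_mul_ofPath_mem_longPaths p q (by omega)

variable (k V) in
-- Lengths add under multiplication. This reduces the vanishing of a representation on a power of
-- the arrow ideal to its vanishing on long paths.
theorem arrowIdeal_pow_le_longPaths (n : ℕ) : arrowIdeal k V ^ n ≤ longPaths k V n := by
  induction n with
  | zero =>
    refine fun y _ => ?_
    rw [← mul_one y]
    refine Ideal.mul_mem_left _ _ ?_
    rw [one_def]
    exact sum_mem fun a _ => ofPath_mem_longPaths _ (Nat.zero_le _)
  | succ n ih =>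
    rw [Submodule.pow_succ]
    refine (Ideal.mul_mono ih fun y hy => ?_).trans (longPaths_mul_le n 1)
    have : y ∈ (longPaths k V 1).toTwoSided := by
      refine TwoSidedIdeal.span_le.2 ?_ (TwoSidedIdeal.mem_asIdeal.1 hy)
      rintro _ ⟨a, b, f, rfl⟩
      exact Ideal.mem_toTwoSided.2 (ofPath_mem_longPaths _ le_rfl)
    exact Ideal.mem_toTwoSided.1 this

theorem ofPath_mem_arrowIdeal_pow {a b : V} (p : Quiver.Path a b) :
    ofPath k p ∈ arrowIdeal k V ^ p.length := by
  induction p with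
  | nil =>
    rw [Quiver.Path.length_nil, Submodule.pow_zero, Ideal.one_eq_top]
    exact Submodule.mem_top
  | cons p f ih =>
    rw [← Quiver.Path.comp_toPath_eq_cons, ← ofPath_comp, Quiver.Path.length_comp,
      Quiver.Path.length_toPath, Ideal.IsTwoSided.pow_succ]
    exact Ideal.mul_mem_mul (TwoSidedIdeal.mem_asIdeal.2
      (TwoSidedIdeal.subset_span ⟨_, _, f, rfl⟩)) ih

end Arrow

section MatrixRep

variable {k : Type u} [Field k] {V : Type v} [Fintype V] [DecidableEq V] [Quiver.{w} V]
  {D : Type x} [CommRing D] [Algebra k D]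

/-- The representation of the path algebra by matrices, in which a path from `a` to `b` acts by its
weight at the place `(b, a)`. -/
noncomputable def matrixRep (wt : ∀ {a b : V}, (a ⟶ b) → D) :
    PathAlgebra k V →ₐ[k] Matrix V V D :=
  let f : PathAlgebra k V →ₗ[k] Matrix V V D := Finsupp.linearCombination k fun p : AnyPath V =>
    Matrix.single p.2.1 p.1 (p.2.2.weight wt)
  have hf : ∀ {a b : V} (p : Quiver.Path a b),
      f (ofPath k p) = Matrix.single b a (p.weight wt) := fun p =>
    (Finsupp.linearCombination_single k _ _).trans (one_smul k _)
  AlgHom.ofLinearMap f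
    (by
      rw [one_def, map_sum]
      simp_rw [hf, Quiver.Path.weight_nil]
      exact Matrix.sum_single_one)
    (fun y z => by
      induction y using PathAlgebra.induction with
      | h0 => simp
      | ha y y' hy hy' => rw [add_mul, map_add, map_add, hy, hy', add_mul]
      | hs c y hy => rw [smul_mul_assoc, map_smul, map_smul, hy, smul_mul_assoc]
      | hp a b p =>
        induction z using PathAlgebra.induction with
        | h0 => simp
        | ha y y' hy hy' => rw [mul_add, map_add, map_add, hy, hy', mul_add]
        | hs c y hy => rw [mul_smul_comm, map_smul, map_smul, hy, mul_smul_comm]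
        | hp a' b' q =>
          rw [hf, hf]
          by_cases h : b' = a
          · subst h
            -- Paths multiply from right to left, whereas weights multiply along the path;
            -- commutativity of `D` reconciles the two orders.
            rw [ofPath_comp, hf, Matrix.single_mul_single_same, Quiver.Path.weight_comp, mul_comm]
          · rw [ofPath_mul_of_ne _ _ h, map_zero, Matrix.single_mul_single_of_ne _ _ _ _ (Ne.symm h)])

theorem matrixRep_ofPath (wt : ∀ {a b : V}, (a ⟶ b) → D) {a b : V} (p : Quiver.Path a b) :
    matrixRep wt (ofPath k p) = Matrix.single b a (p.weight wt) :=
  (Finsupp.linearCombination_single k _ _).trans (one_smul k _)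

end MatrixRep

end PathAlgebra

/-! ### Truncated polynomial algebras -/

/-- Proper quotients of principal ideal domains by nonzero ideals are self-injective. -/
theorem isSelfInjective_quotient_span_singleton {R : Type u} [CommRing R] [IsDomain R]
    [IsPrincipalIdealRing R] {a : R} (ha : a ≠ 0) : IsSelfInjective (R ⧸ Ideal.span {a}) := by
  refine Module.Baer.injective fun I g => ?_
  -- Baer's criterion. Let `d` generate the preimage of `I`, let `a = d c`, and let `y` lift `g d`.
  -- Then `c d = 0` in the quotient forces `a ∣ c y`, hence `y = d z`, and multiplication by `z`
  -- extends `g`.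
  obtain ⟨d, hd⟩ := (IsPrincipalIdealRing.principal (I.comap (Ideal.Quotient.mk (Ideal.span {a})))).1
  rw [← Ideal.span] at hd
  have hdI : Ideal.Quotient.mk (Ideal.span {a}) d ∈ I :=
    Ideal.mem_comap.1 (hd ▸ Ideal.mem_span_singleton_self d)
  obtain ⟨c, hac⟩ : d ∣ a := by
    rw [← Ideal.mem_span_singleton, ← hd, Ideal.mem_comap,
      Ideal.Quotient.eq_zero_iff_mem.2 (Ideal.mem_span_singleton_self a)]
    exact zero_mem I
  obtain ⟨y, hy⟩ := Ideal.Quotient.mk_surjective (g ⟨_, hdI⟩)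
  have hcy : c * y ∈ Ideal.span {a} := by
    rw [← Ideal.Quotient.eq_zero_iff_mem, map_mul, hy, ← smul_eq_mul, ← map_smul]
    convert map_zero g using 2
    refine Subtype.ext ?_
    rw [Submodule.coe_smul, smul_eq_mul, ← map_mul, mul_comm c d, ← hac]
    exact Ideal.Quotient.eq_zero_iff_mem.2 (Ideal.mem_span_singleton_self _)
  obtain ⟨z, hz⟩ := Ideal.mem_span_singleton.1 hcy
  have hyz : y = d * z := mul_left_cancel₀ (right_ne_zero_of_mul (hac ▸ ha)) (by rw [hz, hac]; ring)
  refine ⟨LinearMap.toSpanSingleton _ _ (Ideal.Quotient.mk _ z), fun s hs => ?_⟩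
  obtain ⟨s, rfl⟩ := Ideal.Quotient.mk_surjective s
  obtain ⟨r, rfl⟩ : d ∣ s := by rwa [← Ideal.mem_span_singleton, ← hd, Ideal.mem_comap]
  have : (⟨_, hs⟩ : I) = Ideal.Quotient.mk _ r • ⟨_, hdI⟩ := Subtype.ext (by
    rw [Submodule.coe_smul, smul_eq_mul, ← map_mul, mul_comm r d])
  rw [this, map_smul, ← hy, hyz, LinearMap.toSpanSingleton_apply, smul_eq_mul, smul_eq_mul,
    ← map_mul, ← map_mul]
  congr 1
  ring

namespace TruncatedPolynomial

variable (k : Type u) [Field k] (n : ℕ)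

theorem isSelfInjective : IsSelfInjective (TruncatedPolynomial k n) :=
  isSelfInjective_quotient_span_singleton (pow_ne_zero n Polynomial.X_ne_zero)

instance : Module.Finite k (TruncatedPolynomial k n) :=
  (Polynomial.monic_X_pow n).finite_quotient

/-- The class of the variable. -/
noncomputable def var : TruncatedPolynomial k n := Ideal.Quotient.mk _ Polynomial.X

variable {n}

theorem var_pow_ne_zero {i : ℕ} (hi : i < n) : var k n ^ i ≠ 0 := by
  rw [var, ← map_pow, Ne, Ideal.Quotient.eq_zero_iff_mem, Ideal.mem_span_singleton,
    pow_dvd_pow_iff Polynomial.X_ne_zero Polynomial.not_isUnit_X]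
  omega

theorem var_pow_eq_zero {i : ℕ} (hi : n ≤ i) : var k n ^ i = 0 := by
  rw [var, ← map_pow, Ideal.Quotient.eq_zero_iff_mem, Ideal.mem_span_singleton]
  exact pow_dvd_pow _ hi

theorem not_isSemisimpleRing (hn : 2 ≤ n) : ¬ IsSemisimpleRing (TruncatedPolynomial k n) :=
  -- The element `x ^ (n - 1)` is nonzero and squares to zero, as `2 (n - 1) ≥ n` for `n ≥ 2`.
  fun _ => var_pow_ne_zero k (show n - 1 < n by omega) (eq_zero_of_isSemisimpleRing fun y => by
    rw [mul_right_comm, ← pow_add, var_pow_eq_zero k (by omega), zero_mul])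

open Classical in
variable (n) in
/-- The coefficient of `x ^ s` (zero for `n ≤ s`). -/
noncomputable def coeff (s : ℕ) : TruncatedPolynomial k n →ₗ[k] k :=
  if h : s < n then
    (((Ideal.span {(Polynomial.X : k[X]) ^ n}).restrictScalars k).liftQ (Polynomial.lcoeff k s)
      (fun p hp => by
        obtain ⟨q, rfl⟩ := Ideal.mem_span_singleton.1 hp
        simp [Polynomial.coeff_X_pow_mul', h])) ∘ₗ
      (Submodule.Quotient.restrictScalarsEquiv k
        (Ideal.span {(Polynomial.X : k[X]) ^ n})).symm.toLinearMap
  else 0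

theorem coeff_mk {s : ℕ} (h : s < n) (p : k[X]) :
    coeff k n s (Ideal.Quotient.mk _ p) = p.coeff s := by
  rw [coeff, dif_pos h]
  rfl

theorem coeff_var_pow_mul {l s : ℕ} (h : l + s < n) (d : TruncatedPolynomial k n) :
    coeff k n (l + s) (var k n ^ l * d) = coeff k n s d := by
  obtain ⟨p, rfl⟩ := Ideal.Quotient.mk_surjective d
  rw [var, ← map_pow, ← map_mul, coeff_mk k h, coeff_mk k (by omega), add_comm,
    Polynomial.coeff_X_pow_mul]

theorem coeff_var_pow_mul_of_lt {l s : ℕ} (h : s < l) (d : TruncatedPolynomial k n) :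
    coeff k n s (var k n ^ l * d) = 0 := by
  by_cases hs : s < n
  · obtain ⟨p, rfl⟩ := Ideal.Quotient.mk_surjective d
    rw [var, ← map_pow, ← map_mul, coeff_mk k hs, Polynomial.coeff_X_pow_mul', if_neg (by omega)]
  · rw [coeff, dif_neg hs, LinearMap.zero_apply]

theorem coeff_zero_one (hn : 0 < n) : coeff k n 0 1 = 1 := by
  rw [← map_one (Ideal.Quotient.mk _), coeff_mk k hn, Polynomial.coeff_one_zero]

end TruncatedPolynomial

/-! ### Row and column bimodules of a matrix representation -/

section Matrices

variable {k : Type u} {A : Type v} {D : Type u} [Field k] [Ring A] [Algebra k A] [CommRing D]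
  [Algebra k D] [Module.Finite k D] {V : Type} [Fintype V] [DecidableEq V]

/-- A bimodule with a central element that a bimodule map sends to `1` has the regular bimodule as
a direct summand. -/
theorem RegularIsSummand.of_central (T : Bimodule k A A) (t : T.carrier) (π : T.carrier →ₗ[k] A)
    (ht : π t = 1) (hc : ∀ a : A, a • t = op a • t) (hl : ∀ (a : A) s, π (a • s) = a * π s)
    (hr : ∀ (a : A) s, π (op a • s) = π s * a) : RegularIsSummand T := by
  let l : Module A (LinearMap.ker π) :=
    { smul := fun a s => ⟨a • s.1, by rw [LinearMap.mem_ker, hl, s.2, mul_zero]⟩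
      one_smul := fun s => Subtype.ext (one_smul _ _)
      mul_smul := fun a b s => Subtype.ext (mul_smul _ _ _)
      smul_zero := fun a => Subtype.ext (smul_zero _)
      smul_add := fun a s s' => Subtype.ext (smul_add _ _ _)
      add_smul := fun a b s => Subtype.ext (add_smul _ _ _)
      zero_smul := fun s => Subtype.ext (zero_smul _ _) }
  let r : Module Aᵐᵒᵖ (LinearMap.ker π) :=
    { smul := fun a s => ⟨a • s.1, by
        rw [LinearMap.mem_ker, ← MulOpposite.op_unop a, hr, s.2, zero_mul]⟩
      one_smul := fun s => Subtype.ext (one_smul _ _)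
      mul_smul := fun a b s => Subtype.ext (mul_smul _ _ _)
      smul_zero := fun a => Subtype.ext (smul_zero _)
      smul_add := fun a s s' => Subtype.ext (smul_add _ _ _)
      add_smul := fun a b s => Subtype.ext (add_smul _ _ _)
      zero_smul := fun s => Subtype.ext (zero_smul _ _) }
  let X : Bimodule k A A :=
    { carrier := LinearMap.ker π
      leftModule := l
      rightModule := r
      leftTower := ⟨fun c a s => Subtype.ext (smul_assoc c a s.1)⟩
      rightTower := ⟨fun c a s => Subtype.ext (smul_assoc c a s.1)⟩
      smulComm := ⟨fun a b s => Subtype.ext (smul_comm a b s.1)⟩ }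
  have hproj : ∀ s, π (s - π s • t) = 0 := fun s => by rw [map_sub, hl, ht, mul_one, sub_self]
  -- The section of `π` is `a ↦ a • t`. It is left linear by construction and right linear because
  -- `t` is central, so `ker π` is a complement as a bimodule.
  let e : T.carrier ≃+ A × LinearMap.ker π :=
    { toFun := fun s => (π s, ⟨s - π s • t, hproj s⟩)
      invFun := fun y => y.1 • t + y.2
      left_inv := fun s => add_sub_cancel _ _
      right_inv := fun ⟨a, s, hs⟩ => by
        have : π (a • t + s) = a := by
          rw [map_add, hl, ht, mul_one, LinearMap.mem_ker.1 hs, add_zero]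
        refine Prod.ext this (Subtype.ext ?_)
        change a • t + s - π (a • t + s) • t = s
        rw [this, add_sub_cancel_left]
      map_add' := fun s s' => Prod.ext (map_add π s s') (Subtype.ext (by
        change s + s' - π (s + s') • t = (s - π s • t) + (s' - π s' • t)
        rw [map_add, add_smul]
        abel)) }
  refine ⟨X, e, fun a s => Prod.ext (hl a s) (Subtype.ext ?_),
    fun a s => Prod.ext (hr a s) (Subtype.ext ?_)⟩
  · change a • s - π (a • s) • t = a • (s - π s • t)
    rw [hl, mul_smul, smul_sub]
  · change op a • s - π (op a • s) • t = op a • (s - π s • t)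
    rw [hr, mul_smul, smul_sub, hc, smul_comm]

open Matrix

/-- The column vectors over `D`, on which `A` acts through a matrix representation. -/
noncomputable def colBimodule (φ : A →ₐ[k] Matrix V V D) : Bimodule k A D :=
  letI l : Module A (V → D) :=
    { smul := fun a v => φ a *ᵥ v
      one_smul := fun v => by
        change φ 1 *ᵥ v = v
        rw [map_one, one_mulVec]
      mul_smul := fun a b v => by
        change φ (a * b) *ᵥ v = φ a *ᵥ φ b *ᵥ v
        rw [map_mul, mulVec_mulVec]
      smul_zero := fun a => mulVec_zero _
      smul_add := fun a v v' => mulVec_add _ _ _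
      add_smul := fun a b v => by
        change φ (a + b) *ᵥ v = φ a *ᵥ v + φ b *ᵥ v
        rw [map_add, add_mulVec]
      zero_smul := fun v => by
        change φ 0 *ᵥ v = 0
        rw [map_zero, zero_mulVec] }
  { carrier := V → D
    leftModule := l
    leftTower := ⟨fun c a v => by
      change φ (c • a) *ᵥ v = c • (φ a *ᵥ v)
      rw [map_smul, smul_mulVec]⟩
    smulComm := ⟨fun a d v => by
      change φ a *ᵥ (d • v) = d • (φ a *ᵥ v)
      rw [mulVec_smul]⟩ }

/-- The row vectors over `D`, on which `A` acts through a matrix representation. -/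
noncomputable def rowBimodule (φ : A →ₐ[k] Matrix V V D) : Bimodule k D A :=
  letI r : Module Aᵐᵒᵖ (V → D) :=
    { smul := fun a v => v ᵥ* φ a.unop
      one_smul := fun v => by
        change v ᵥ* φ 1 = v
        rw [map_one, vecMul_one]
      mul_smul := fun a b v => by
        change v ᵥ* φ (b.unop * a.unop) = (v ᵥ* φ b.unop) ᵥ* φ a.unop
        rw [map_mul, vecMul_vecMul]
      smul_zero := fun a => zero_vecMul _
      smul_add := fun a v v' => add_vecMul _ _ _
      add_smul := fun a b v => by
        change v ᵥ* φ (a.unop + b.unop) = v ᵥ* φ a.unop + v ᵥ* φ b.unop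
        rw [map_add, vecMul_add]
      zero_smul := fun v => by
        change v ᵥ* φ 0 = 0
        rw [map_zero, vecMul_zero] }
  { carrier := V → D
    rightModule := r
    rightTower := ⟨fun c a v => by
      change v ᵥ* φ (c • a.unop) = c • (v ᵥ* φ a.unop)
      rw [map_smul, vecMul_smul]⟩
    smulComm := ⟨fun d a v => by
      change d • (v ᵥ* φ a.unop) = (d • v) ᵥ* φ a.unop
      rw [smul_vecMul]⟩ }

end Matrices

section Matrices

open Matrix BalancedTensor

variable {k : Type u} {A : Type v} {D : Type u} [Field k] [Ring A] [Algebra k A] [CommRing D]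
  [Algebra k D] [Module.Finite k D] {V : Type} [Fintype V] [DecidableEq V]

/-- The regular bimodule of `A` is a direct summand of the matrices over `D` if the representation
of `A` has a left inverse that is a bimodule map. -/
theorem JLE.of_matrix (φ : A →ₐ[k] Matrix V V D) (τ : Matrix V V D →ₗ[k] A) (h1 : τ 1 = 1)
    (hl : ∀ a X, τ (φ a * X) = a * τ X) (hr : ∀ a X, τ (X * φ a) = τ X * a) : JLE k D A := by
  refine ⟨colBimodule φ, rowBimodule φ, ?_⟩
  let tm (v w : V → D) : ((colBimodule φ).tensor (rowBimodule φ)).carrier :=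
    tmul k D (M := (colBimodule φ).carrier) (N := (rowBimodule φ).carrier) v w
  let mkL (w : V → D) : (V → D) →+ ((colBimodule φ).tensor (rowBimodule φ)).carrier :=
    { toFun := fun v => tm v w
      map_zero' := zero_tmul (k := k) (B := D) (M := (colBimodule φ).carrier)
        (N := (rowBimodule φ).carrier) w
      map_add' := fun v v' => add_tmul (k := k) (B := D) (M := (colBimodule φ).carrier)
        (N := (rowBimodule φ).carrier) v v' w }
  let mkR (v : V → D) : (V → D) →+ ((colBimodule φ).tensor (rowBimodule φ)).carrier :=
    { toFun := fun w => tm v w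
      map_zero' := tmul_zero (k := k) (B := D) (M := (colBimodule φ).carrier)
        (N := (rowBimodule φ).carrier) v
      map_add' := fun w w' => tmul_add (k := k) (B := D) (M := (colBimodule φ).carrier)
        (N := (rowBimodule φ).carrier) v w w' }
  -- A column times a row is a matrix, so `τ` induces a map on columns tensored with rows.
  let β : (V → D) →ₗ[k] (V → D) →ₗ[k] A :=
    LinearMap.mk₂ k (fun v w => τ (vecMulVec v w))
      (fun v v' w => by rw [add_vecMulVec, map_add])
      (fun c v w => by rw [smul_vecMulVec, map_smul])
      (fun v w w' => by rw [vecMulVec_add, map_add])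
      (fun c v w => by rw [vecMulVec_smul, map_smul])
  have hβ : ∀ (v : V → D) (d : D) (w : V → D), β (op d • v) w = β v (d • w) := fun v d w => by
    change τ (vecMulVec (op d • v) w) = τ (vecMulVec v (d • w))
    congr 1
    ext i j
    simp [vecMulVec_apply, mul_assoc, mul_left_comm]
  let π : ((colBimodule φ).tensor (rowBimodule φ)).carrier →ₗ[k] A :=
    lift (k := k) (A := D) (M := (colBimodule φ).carrier) (X := (rowBimodule φ).carrier) β hβ
  have π_tm : ∀ v w, π (tm v w) = τ (vecMulVec v w) := fun v w => lift_tmul _ _ _ _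
  have hind : ∀ (p : ((colBimodule φ).tensor (rowBimodule φ)).carrier → Prop), p 0 →
      (∀ v w, p (tm v w)) → (∀ s t, p s → p t → p (s + t)) → ∀ t, p t :=
    fun p h0 ht ha t => BalancedTensor.induction (p := p) t h0 ht ha
  -- The sum of the `e_i ⊗ e_i` corresponds to the identity matrix. It is central because the
  -- entries `φ(a)_{ji}` lie in `D` and move across the tensor sign.
  refine RegularIsSummand.of_central _ (∑ i, tm (Pi.single i 1) (Pi.single i 1)) π ?_
    (fun a => ?_) (fun a s => ?_) (fun a s => ?_)
  · rw [map_sum, ← h1]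
    simp_rw [π_tm]
    rw [← map_sum]
    congr 1
    ext i j
    simp [Matrix.sum_apply, vecMulVec_apply, Matrix.one_apply, Pi.single_apply]
  · rw [Finset.smul_sum, Finset.smul_sum]
    have hL : ∀ i, a • tm (Pi.single i 1) (Pi.single i 1) =
        ∑ j, tm (Pi.single j (φ a j i)) (Pi.single i 1) := fun i => by
      refine Eq.trans ?_ (map_sum (mkL (Pi.single i 1)) (fun j => Pi.single j (φ a j i)) _)
      change tm (φ a *ᵥ Pi.single i 1) _ = tm _ _
      congr 1
      ext j
      simp [Finset.sum_apply, Pi.single_apply]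
    have hR : ∀ j, op a • tm (Pi.single j 1) (Pi.single j 1) =
        ∑ i, tm (Pi.single j 1) (Pi.single i (φ a j i)) := fun j => by
      refine Eq.trans ?_ (map_sum (mkR (Pi.single j 1)) (fun i => Pi.single i (φ a j i)) _)
      change tm _ (Pi.single j 1 ᵥ* φ a) = tm _ _
      congr 1
      ext i
      simp [Finset.sum_apply, Pi.single_apply]
    simp_rw [hL, hR]
    rw [Finset.sum_comm]
    refine Finset.sum_congr rfl fun j _ => Finset.sum_congr rfl fun i _ => ?_
    have hj : (Pi.single j (φ a j i) : V → D) = op (φ a j i) • Pi.single j 1 := by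
      rw [← Pi.single_smul, MulOpposite.smul_eq_mul_unop, one_mul, MulOpposite.unop_op]
    have hi : (Pi.single i (φ a j i) : V → D) = φ a j i • Pi.single i 1 := by
      rw [← Pi.single_smul, smul_eq_mul, mul_one]
    rw [hj, hi]
    exact tmul_balanced (k := k) (A := D) (M := (colBimodule φ).carrier)
      (X := (rowBimodule φ).carrier) _ _ _
  · refine hind (fun s => π (a • s) = a * π s) (by simp) (fun v w => ?_) (fun s t hs ht => ?_) s
    · change π (tm (φ a *ᵥ v) w) = _
      rw [π_tm, π_tm, ← hl, mul_vecMulVec]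
    · rw [smul_add, map_add, map_add, hs, ht, mul_add]
  · refine hind (fun s => π (op a • s) = π s * a) (by simp) (fun v w => ?_) (fun s t hs ht => ?_) s
    · change π (tm v (w ᵥ* φ a)) = _
      rw [π_tm, π_tm, ← hr, vecMulVec_mul]
    · rw [smul_add, map_add, map_add, hs, ht, add_mul]

end Matrices

/-! ### The Kronecker algebra -/

namespace Kronecker

open Matrix BalancedTensor

theorem isAcyclicQuiver : IsAcyclicQuiver Kronecker
  | one, .nil => rfl
  | two, .nil => rfl
  | two, .cons (b := one) p _ => nomatch p

/-- The first arrow. -/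
def alpha : one ⟶ two := Arrow.alpha

/-- The second arrow. -/
def beta : one ⟶ two := Arrow.beta

/-- All paths of the Kronecker quiver: the two vertices and the two arrows. -/
def anyPath : Kronecker ⊕ Bool → AnyPath Kronecker
  | .inl a => ⟨a, a, .nil⟩
  | .inr true => ⟨one, two, alpha.toPath⟩
  | .inr false => ⟨one, two, beta.toPath⟩

theorem anyPath_surjective : Function.Surjective anyPath
  | ⟨a, _, .nil⟩ => ⟨.inl a, rfl⟩
  | ⟨_, _, .cons .nil .alpha⟩ => ⟨.inr true, rfl⟩
  | ⟨_, _, .cons .nil .beta⟩ => ⟨.inr false, rfl⟩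

variable (k : Type u) [Field k]

instance : Module.Finite k (KroneckerAlgebra k) :=
  have := Finite.of_surjective anyPath anyPath_surjective
  inferInstanceAs (Module.Finite k (AnyPath Kronecker →₀ k))

theorem not_isSemisimpleRing : ¬ IsSemisimpleRing (KroneckerAlgebra k) := fun _ => by
  have hempty : IsEmpty (Quiver.Path two one) := ⟨fun
    | .cons _ f => nomatch (show Arrow _ one from f)⟩
  have h : PathAlgebra.ofPath k alpha.toPath = 0 :=
    eq_zero_of_isSemisimpleRing (PathAlgebra.ofPath_mul_mul_ofPath k _ _ hempty)
  exact one_ne_zero (Finsupp.single_eq_zero.1 h)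

/-- The weights `1` and `x` of the two arrows. -/
def weight {D : Type u} [One D] (x : D) : ∀ {a b : Kronecker}, (a ⟶ b) → D
  | _, _, Arrow.alpha => 1
  | _, _, Arrow.beta => x

/-- A commutative algebra `D` generated by one element `x` satisfies `Θ ≤_J D`. -/
theorem jle_of_adjoin_eq_top {D : Type u} [CommRing D] [Algebra k D] [Module.Finite k D] {x : D}
    (hD : Algebra.adjoin k {x} = ⊤) : JLE k (KroneckerAlgebra k) D := by
  let φ : KroneckerAlgebra k →ₐ[k] Matrix Kronecker Kronecker D :=
    PathAlgebra.matrixRep (weight x)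
  let α := PathAlgebra.ofPath k (alpha.toPath)
  let β := PathAlgebra.ofPath k (beta.toPath)
  have hα : φ α = Matrix.single two one 1 := by
    refine (PathAlgebra.matrixRep_ofPath _ _).trans ?_
    simp [Quiver.Hom.toPath, weight, alpha]
  have hβ : φ β = Matrix.single two one x := by
    refine (PathAlgebra.matrixRep_ofPath _ _).trans ?_
    simp [Quiver.Hom.toPath, weight, beta]
  refine ⟨rowBimodule φ, colBimodule φ, ?_⟩
  let tm (v w : Kronecker → D) : ((rowBimodule φ).tensor (colBimodule φ)).carrier :=
    tmul k (KroneckerAlgebra k) (M := (rowBimodule φ).carrier) (N := (colBimodule φ).carrier) v w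
  have tm_add : ∀ v w w', tm v (w + w') = tm v w + tm v w' := fun v w w' =>
    tmul_add (k := k) (B := KroneckerAlgebra k) (M := (rowBimodule φ).carrier)
      (N := (colBimodule φ).carrier) v w w'
  have add_tm : ∀ v v' w, tm (v + v') w = tm v w + tm v' w := fun v v' w =>
    add_tmul (k := k) (B := KroneckerAlgebra k) (M := (rowBimodule φ).carrier)
      (N := (colBimodule φ).carrier) v v' w
  have smul_tm : ∀ (c : k) v w, tm (c • v) w = tm v (c • w) := fun c v w =>
    (smul_tmul (k := k) (B := KroneckerAlgebra k) (M := (rowBimodule φ).carrier)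
      (N := (colBimodule φ).carrier) c v w).trans (tmul_smul (k := k) (B := KroneckerAlgebra k)
      (M := (rowBimodule φ).carrier) (N := (colBimodule φ).carrier) c v w).symm
  have hbal : ∀ (y : KroneckerAlgebra k) v w, tm (v ᵥ* φ y) w = tm v (φ y *ᵥ w) := fun y v w =>
    tmul_balanced (k := k) (A := KroneckerAlgebra k) (M := (rowBimodule φ).carrier)
      (X := (colBimodule φ).carrier) v y w
  have hrow : ∀ c d : D, (Pi.single two c : Kronecker → D) ᵥ* Matrix.single two one d =
      Pi.single one (c * d) := fun c d => by
    ext (_ | _) <;> simp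
  have hcol : ∀ c d : D, Matrix.single two one c *ᵥ (Pi.single one d : Kronecker → D) =
      Pi.single two (c * d) := fun c d => by
    ext (_ | _) <;> simp
  -- Pass through vertex `two` by one arrow and return by the other: `e₁cx ⊗ e₁d = e₂cβ ⊗ e₁d = e₂c
  -- ⊗ βe₁d = e₂c ⊗ αe₁xd = e₁c ⊗ e₁xd`.
  have hx : ∀ c d : D, tm (Pi.single one (c * x)) (Pi.single one d) =
      tm (Pi.single one c) (Pi.single one (x * d)) := fun c d => by
    rw [← hrow, ← hβ, hbal, hβ, hcol]
    have h := hbal α (Pi.single two c) (Pi.single one (x * d))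
    rw [hα, hrow, hcol, mul_one, one_mul] at h
    exact h.symm
  -- As `x` generates `D`, every scalar moves across the tensor sign at vertex `one`. This makes `e₁
  -- ⊗ e₁` central.
  have hmid : ∀ q c d : D, tm (Pi.single one (c * q)) (Pi.single one d) =
      tm (Pi.single one c) (Pi.single one (q * d)) := fun q => by
    have hq : q ∈ Algebra.adjoin k {x} := hD ▸ Algebra.mem_top
    induction hq using Algebra.adjoin_induction with
    | mem q hq =>
      rw [Set.mem_singleton_iff.1 hq]
      exact hx
    | algebraMap r =>
      intro c d
      rw [mul_comm, ← Algebra.smul_def, ← Algebra.smul_def, Pi.single_smul, Pi.single_smul, smul_tm]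
    | add p q _ _ hp hq =>
      intro c d
      rw [mul_add, add_mul, Pi.single_add, Pi.single_add, add_tm, tm_add, hp, hq]
    | mul p q _ _ hp hq =>
      intro c d
      rw [← mul_assoc, hq, hp, mul_assoc]
  let γ : (Kronecker → D) →ₗ[k] (Kronecker → D) →ₗ[k] D :=
    LinearMap.mk₂ k (fun v w => v ⬝ᵥ w) add_dotProduct smul_dotProduct dotProduct_add
      fun c v w => dotProduct_smul c v w
  let π : ((rowBimodule φ).tensor (colBimodule φ)).carrier →ₗ[k] D :=
    lift (k := k) (A := KroneckerAlgebra k) (M := (rowBimodule φ).carrier)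
      (X := (colBimodule φ).carrier) γ fun v y w => (dotProduct_mulVec v (φ y) w).symm
  have π_tm : ∀ v w, π (tm v w) = v ⬝ᵥ w := fun v w => lift_tmul _ _ _ _
  have hind : ∀ (p : ((rowBimodule φ).tensor (colBimodule φ)).carrier → Prop), p 0 →
      (∀ v w, p (tm v w)) → (∀ s t, p s → p t → p (s + t)) → ∀ t, p t :=
    fun p h0 ht ha t => BalancedTensor.induction (p := p) t h0 ht ha
  refine RegularIsSummand.of_central _ (tm (Pi.single one 1) (Pi.single one 1)) π ?_
    (fun a => ?_) (fun a s => ?_) (fun a s => ?_)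
  · rw [π_tm]
    simp
  · have h := hmid a 1 1
    rw [one_mul, mul_one] at h
    have hl : (a • Pi.single one 1 : Kronecker → D) = Pi.single one a := by
      rw [← Pi.single_smul, smul_eq_mul, mul_one]
    have hr : (op a • Pi.single one 1 : Kronecker → D) = Pi.single one a := by
      rw [← Pi.single_smul, MulOpposite.smul_eq_mul_unop, one_mul, MulOpposite.unop_op]
    change tm (a • Pi.single one 1) _ = tm _ (op a • Pi.single one 1)
    rw [hl, hr]
    exact h
  · refine hind (fun s => π (a • s) = a * π s) (by simp) (fun v w => ?_) (fun s t hs ht => ?_) s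
    · change π (tm (a • v) w) = _
      rw [π_tm, π_tm, smul_dotProduct, smul_eq_mul]
    · rw [smul_add, map_add, map_add, hs, ht, mul_add]
  · refine hind (fun s => π (op a • s) = π s * a) (by simp) (fun v w => ?_) (fun s t hs ht => ?_) s
    · change π (tm v (op a • w)) = _
      rw [π_tm, π_tm, dotProduct_smul]
      rfl
    · rw [smul_add, map_add, map_add, hs, ht, add_mul]

theorem jle : JLE k (KroneckerAlgebra k) (TruncatedPolynomial k 2) := by
  refine jle_of_adjoin_eq_top k (x := TruncatedPolynomial.var k 2) ?_
  have h := congrArg (Subalgebra.map (Ideal.Quotient.mkₐ k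
    (Ideal.span {(Polynomial.X : k[X]) ^ 2}))) (Polynomial.adjoin_X (R := k))
  rwa [AlgHom.map_adjoin, Set.image_singleton, Algebra.map_top,
    (AlgHom.range_eq_top _).2 (Ideal.Quotient.mkₐ_surjective k _)] at h

end Kronecker

/-! ### Truncated path algebras of linear quivers -/

namespace LinearQuiver

variable {m : ℕ}

instance : DecidableEq (LinearQuiver m) := (equivFin m).decidableEq

theorem idx_add_length {i j : LinearQuiver m} (p : Quiver.Path i j) :
    i.idx.val + p.length = j.idx.val := by
  induction p with
  | nil => rfl
  | cons p f ih =>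
    rw [Quiver.Path.length_cons, ← add_assoc, ih]
    exact f.down

theorem isAcyclicQuiver : IsAcyclicQuiver (LinearQuiver m) := fun i p =>
  p.eq_nil_of_length_zero (by have := idx_add_length p; omega)

/-- An arrow raises the index by one, so the last arrow of a path is determined by its target. Hence
`basisElem` does not depend on the chosen path. -/
theorem path_subsingleton {i j : LinearQuiver m} (p q : Quiver.Path i j) : p = q := by
  induction p with
  | nil => exact (isAcyclicQuiver i q).symm
  | @cons b c p f ih =>
    cases q with
    | nil =>
      have h := idx_add_length (p.cons f)
      rw [Quiver.Path.length_cons] at h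
      omega
    | @cons b' _ q g =>
      obtain ⟨⟨b⟩⟩ := b
      obtain ⟨⟨b'⟩⟩ := b'
      have hf := f.down
      have hg := g.down
      obtain rfl : b = b' := by
        simp only at hf hg
        omega
      rw [ih q, Subsingleton.elim (α := PLift (_ = _)) f g]

theorem nonempty_path {i j : LinearQuiver m} (h : i.idx.val ≤ j.idx.val) :
    Nonempty (Quiver.Path i j) := by
  obtain ⟨d, hd⟩ := Nat.exists_eq_add_of_le h
  induction d generalizing j with
  | zero =>
    obtain ⟨i⟩ := i
    obtain ⟨j⟩ := j
    obtain rfl : i = j := Fin.ext hd.symm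
    exact ⟨.nil⟩
  | succ d ih =>
    have hj := j.idx.isLt
    obtain ⟨p⟩ := @ih ⟨⟨i.idx.val + d, by omega⟩⟩ (Nat.le_add_right _ _) rfl
    exact ⟨p.cons ⟨by simp only; omega⟩⟩

end LinearQuiver

namespace TruncatedLinear

open LinearQuiver PathAlgebra

variable (k : Type u) [Field k] (m n : ℕ)

variable {m} in
theorem weight_var {a b : LinearQuiver m} (p : Quiver.Path a b) :
    p.weight (fun _ => TruncatedPolynomial.var k n) = TruncatedPolynomial.var k n ^ p.length := by
  induction p with
  | nil => simp
  | cons p f ih => rw [Quiver.Path.weight_cons, ih, Quiver.Path.length_cons, pow_succ]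

/-- The representation in which every arrow acts by `x`. -/
noncomputable def rep : TruncatedLinear k m n →ₐ[k]
    Matrix (LinearQuiver m) (LinearQuiver m) (TruncatedPolynomial k n) :=
  Ideal.Quotient.liftₐ _ (matrixRep fun _ => TruncatedPolynomial.var k n) (by
    -- A path acts by `x` to the power of its length, which vanishes from length `n` on.
    have h : longPaths k (LinearQuiver m) n ≤ RingHom.ker (matrixRep (k := k)
        (V := LinearQuiver m) fun _ => TruncatedPolynomial.var k n) := by
      refine Ideal.span_le.2 ?_
      rintro _ ⟨a, b, p, hp, rfl⟩
      refine (matrixRep_ofPath _ p).trans ?_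
      rw [weight_var, TruncatedPolynomial.var_pow_eq_zero k hp, Matrix.single_zero]
    exact fun y hy => h (arrowIdeal_pow_le_longPaths k _ n hy))

variable {m}

/-- The class of a path. -/
noncomputable def mkPath {i j : LinearQuiver m} (p : Quiver.Path i j) : TruncatedLinear k m n :=
  Ideal.Quotient.mk _ (ofPath k p)

theorem rep_mkPath {i j : LinearQuiver m} (p : Quiver.Path i j) :
    rep k m n (mkPath k n p) = Matrix.single j i (TruncatedPolynomial.var k n ^ p.length) := by
  rw [← weight_var]
  exact matrixRep_ofPath _ p

theorem mkPath_mul_mkPath {a b c : LinearQuiver m} (q : Quiver.Path a b) (p : Quiver.Path b c) :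
    mkPath k n p * mkPath k n q = mkPath k n (q.comp p) := by
  rw [mkPath, mkPath, ← map_mul, ofPath_comp, mkPath]

theorem mkPath_mul_mkPath_of_ne {a b c d : LinearQuiver m} (p : Quiver.Path c d)
    (q : Quiver.Path a b) (h : b ≠ c) : mkPath k n p * mkPath k n q = 0 := by
  rw [mkPath, mkPath, ← map_mul, ofPath_mul_of_ne _ _ h, map_zero]

theorem mkPath_eq_zero {i j : LinearQuiver m} (p : Quiver.Path i j) (hp : n ≤ p.length) :
    mkPath k n p = 0 :=
  Ideal.Quotient.eq_zero_iff_mem.2 (Ideal.pow_le_pow_right hp (ofPath_mem_arrowIdeal_pow p))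

open Classical in
/-- The class of the path from `i` to `j`, zero if there is none. -/
noncomputable def basisElem (i j : LinearQuiver m) : TruncatedLinear k m n :=
  if h : Nonempty (Quiver.Path i j) then mkPath k n h.some else 0

theorem basisElem_of_path {i j : LinearQuiver m} (p : Quiver.Path i j) :
    basisElem k n i j = mkPath k n p := by
  rw [basisElem, dif_pos ⟨p⟩, path_subsingleton p (Nonempty.some ⟨p⟩)]

theorem basisElem_of_lt {i j : LinearQuiver m} (h : j.idx.val < i.idx.val) :
    basisElem k n i j = 0 :=
  dif_neg fun ⟨p⟩ => by have := idx_add_length p; omega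

theorem mkPath_mul_basisElem {a b i : LinearQuiver m} (p : Quiver.Path a b)
    (h : i.idx.val ≤ a.idx.val) : mkPath k n p * basisElem k n i a = basisElem k n i b := by
  obtain ⟨q⟩ := nonempty_path h
  rw [basisElem_of_path k n q, mkPath_mul_mkPath, basisElem_of_path]

theorem mkPath_mul_basisElem_of_ne {a b i j : LinearQuiver m} (p : Quiver.Path a b)
    (h : j ≠ a) : mkPath k n p * basisElem k n i j = 0 := by
  by_cases hij : i.idx.val ≤ j.idx.val
  · obtain ⟨q⟩ := nonempty_path hij
    rw [basisElem_of_path k n q, mkPath_mul_mkPath_of_ne k n p q h]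
  · rw [basisElem_of_lt k n (not_le.1 hij), mul_zero]

theorem basisElem_mul_mkPath {a b j : LinearQuiver m} (p : Quiver.Path a b)
    (h : b.idx.val ≤ j.idx.val) : basisElem k n b j * mkPath k n p = basisElem k n a j := by
  obtain ⟨q⟩ := nonempty_path h
  rw [basisElem_of_path k n q, mkPath_mul_mkPath, basisElem_of_path]

theorem basisElem_mul_mkPath_of_ne {a b i j : LinearQuiver m} (p : Quiver.Path a b)
    (h : i ≠ b) : basisElem k n i j * mkPath k n p = 0 := by
  by_cases hij : i.idx.val ≤ j.idx.val
  · obtain ⟨q⟩ := nonempty_path hij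
    rw [basisElem_of_path k n q, mkPath_mul_mkPath_of_ne k n q p h.symm]
  · rw [basisElem_of_lt k n (not_le.1 hij), zero_mul]

theorem basisElem_eq_zero {i j : LinearQuiver m} (h : n ≤ j.idx.val - i.idx.val) :
    basisElem k n i j = 0 := by
  by_cases hij : i.idx.val ≤ j.idx.val
  · obtain ⟨q⟩ := nonempty_path hij
    rw [basisElem_of_path k n q, mkPath_eq_zero]
    have := idx_add_length q
    omega
  · exact basisElem_of_lt k n (not_le.1 hij)

variable (m) in
/-- The bimodule map from matrices that picks the coefficient of `x ^ (j - i)` at the place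
`(j, i)`. -/
noncomputable def retraction :
    Matrix (LinearQuiver m) (LinearQuiver m) (TruncatedPolynomial k n) →ₗ[k]
      TruncatedLinear k m n :=
  ∑ j, ∑ i, (TruncatedPolynomial.coeff k n (j.idx.val - i.idx.val) ∘ₗ
    Matrix.entryLinearMap k (TruncatedPolynomial k n) j i).smulRight (basisElem k n i j)

theorem retraction_apply
    (X : Matrix (LinearQuiver m) (LinearQuiver m) (TruncatedPolynomial k n)) :
    retraction k m n X = ∑ j, ∑ i,
      TruncatedPolynomial.coeff k n (j.idx.val - i.idx.val) (X j i) • basisElem k n i j := by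
  simp [retraction, LinearMap.sum_apply]

theorem induction {P : TruncatedLinear k m n → Prop} (y : TruncatedLinear k m n)
    (hp : ∀ {i j : LinearQuiver m} (p : Quiver.Path i j), P (mkPath k n p))
    (ha : ∀ y z, P y → P z → P (y + z)) (hs : ∀ (c : k) y, P y → P (c • y)) (h0 : P 0) : P y := by
  obtain ⟨y, rfl⟩ := Ideal.Quotient.mk_surjective y
  induction y using PathAlgebra.induction with
  | h0 => rwa [map_zero]
  | ha y z hy hz => rw [map_add]; exact ha _ _ hy hz
  | hs c y hy => exact hs c _ hy
  | hp a b p => exact hp p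

variable {n}

theorem retraction_one (hn : 0 < n) : retraction k m n 1 = 1 := by
  rw [retraction_apply, ← map_one (Ideal.Quotient.mk _), one_def, map_sum]
  refine Finset.sum_congr rfl fun j _ => ?_
  rw [Finset.sum_eq_single j]
  · rw [Matrix.one_apply_eq, Nat.sub_self, TruncatedPolynomial.coeff_zero_one k hn, one_smul,
      basisElem_of_path k n .nil]
    rfl
  · intro i _ hi
    rw [Matrix.one_apply_ne hi.symm, map_zero, zero_smul]
  · simp

/-- A path from `a` to `b` multiplies row `a` by `x ^ (b - a)` and places it in row `b`; the
coefficient of degree `b - i` read there is the one of degree `a - i` read before. -/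
theorem retraction_rep_mul (y : TruncatedLinear k m n)
    (X : Matrix (LinearQuiver m) (LinearQuiver m) (TruncatedPolynomial k n)) :
    retraction k m n (rep k m n y * X) = y * retraction k m n X := by
  induction y using TruncatedLinear.induction with
  | h0 => simp
  | ha y z hy hz => rw [map_add, add_mul, map_add, hy, hz, add_mul]
  | hs c y hy => rw [map_smul, Matrix.smul_mul, map_smul, hy, smul_mul_assoc]
  | @hp a b p =>
    have hlen := idx_add_length p
    rw [rep_mkPath, retraction_apply, retraction_apply, Finset.mul_sum]
    refine (Finset.sum_eq_single_of_mem b (Finset.mem_univ b) ?_).trans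
      (Eq.trans ?_ (Finset.sum_eq_single_of_mem a (Finset.mem_univ a) ?_).symm)
    · intro j _ hj
      refine Finset.sum_eq_zero fun i _ => ?_
      rw [Matrix.single_mul_apply_of_ne _ _ _ _ _ hj, map_zero, zero_smul]
    · rw [Finset.mul_sum]
      refine Finset.sum_congr rfl fun i _ => ?_
      rw [Matrix.single_mul_apply_same, mul_smul_comm]
      rcases le_or_gt i.idx.val a.idx.val with hi | hi
      · rw [mkPath_mul_basisElem k n p hi]
        rcases lt_or_ge (b.idx.val - i.idx.val) n with hb | hb
        · have : b.idx.val - i.idx.val = p.length + (a.idx.val - i.idx.val) := by omega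
          rw [this, TruncatedPolynomial.coeff_var_pow_mul k (by omega)]
        · rw [basisElem_eq_zero k n hb, smul_zero, smul_zero]
      -- For `i > a` the right side is zero. On the left, `i ≤ b` gives a degree `b - i` below the
      -- shift `b - a`, while for `i > b` there is no path from `i` to `b`.
      · rw [basisElem_of_lt k n hi, mul_zero, smul_zero]
        rcases le_or_gt i.idx.val b.idx.val with hb | hb
        · rw [TruncatedPolynomial.coeff_var_pow_mul_of_lt k (by omega), zero_smul]
        · rw [basisElem_of_lt k n hb, smul_zero]
    · intro j _ hj
      rw [Finset.mul_sum]
      refine Finset.sum_eq_zero fun i _ => ?_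
      rw [mul_smul_comm, mkPath_mul_basisElem_of_ne k n p hj, smul_zero]

theorem retraction_mul_rep (y : TruncatedLinear k m n)
    (X : Matrix (LinearQuiver m) (LinearQuiver m) (TruncatedPolynomial k n)) :
    retraction k m n (X * rep k m n y) = retraction k m n X * y := by
  induction y using TruncatedLinear.induction with
  | h0 => simp
  | ha y z hy hz => rw [map_add, mul_add, map_add, hy, hz, mul_add]
  | hs c y hy => rw [map_smul, Matrix.mul_smul, map_smul, hy, mul_smul_comm]
  | @hp a b p =>
    have hlen := idx_add_length p
    rw [rep_mkPath, retraction_apply, retraction_apply, Finset.sum_mul]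
    refine Finset.sum_congr rfl fun j _ => ?_
    rw [Finset.sum_eq_single a, Finset.sum_mul, Finset.sum_eq_single b]
    · rw [Matrix.mul_single_apply_same, smul_mul_assoc, mul_comm]
      rcases le_or_gt b.idx.val j.idx.val with hj | hj
      · rw [basisElem_mul_mkPath k n p hj]
        rcases lt_or_ge (j.idx.val - a.idx.val) n with hb | hb
        · have : j.idx.val - a.idx.val = p.length + (j.idx.val - b.idx.val) := by omega
          rw [this, TruncatedPolynomial.coeff_var_pow_mul k (by omega)]
        · rw [basisElem_eq_zero k n hb, smul_zero, smul_zero]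
      · rw [basisElem_of_lt k n hj, zero_mul, smul_zero]
        rcases le_or_gt a.idx.val j.idx.val with ha | ha
        · rw [TruncatedPolynomial.coeff_var_pow_mul_of_lt k (by omega), zero_smul]
        · rw [basisElem_of_lt k n ha, smul_zero]
    · intro i _ hi
      rw [smul_mul_assoc, basisElem_mul_mkPath_of_ne k n p hi, smul_zero]
    · simp
    · intro i _ hi
      rw [Matrix.mul_single_apply_of_ne _ _ _ _ _ hi, map_zero, zero_smul]
    · simp

theorem jle (hn : 0 < n) : JLE k (TruncatedPolynomial k n) (TruncatedLinear k m n) :=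
  JLE.of_matrix (rep k m n) (retraction k m n) (retraction_one k hn) (retraction_rep_mul k)
    (retraction_mul_rep k)

/-- The retraction is onto, since it sends `rep y = rep y * 1` to `y * 1`; finiteness is inherited
from the matrices. -/
theorem module_finite (hn : 0 < n) : Module.Finite k (TruncatedLinear k m n) :=
  Module.Finite.of_surjective (retraction k m n) fun y => ⟨rep k m n y, by
    rw [← mul_one (rep k m n y), retraction_rep_mul, retraction_one k hn, mul_one]⟩

theorem not_isSemisimpleRing (hm : 2 ≤ m) (hn : 2 ≤ n) :
    ¬ IsSemisimpleRing (TruncatedLinear k m n) := fun _ => by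
  let i : LinearQuiver m := ⟨⟨0, by omega⟩⟩
  let j : LinearQuiver m := ⟨⟨1, by omega⟩⟩
  let f : i ⟶ j := ⟨rfl⟩
  have hempty : IsEmpty (Quiver.Path j i) := ⟨fun p => by
    have : 1 + p.length = 0 := idx_add_length p
    omega⟩
  have h : mkPath k n f.toPath = 0 := eq_zero_of_isSemisimpleRing fun y => by
    obtain ⟨y, rfl⟩ := Ideal.Quotient.mk_surjective y
    rw [mkPath, ← map_mul, ← map_mul, ofPath_mul_mul_ofPath k _ _ hempty, map_zero]
  have h' := congrFun (congrFun (rep_mkPath k n f.toPath) j) i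
  rw [h, map_zero, Matrix.single_apply_same] at h'
  -- The arrow is nonzero in the quotient because it acts by `x`, and `x ≠ 0` as `n ≥ 2`.
  exact TruncatedPolynomial.var_pow_ne_zero k (n := n) (by rw [Quiver.Path.length_toPath]; omega)
    h'.symm

end TruncatedLinear

end SepRel

/-! ### The general obstruction and the examples combined. -/

theorem corollary7p2 (k : Type u) [Field k] :
    (∀ (A : Type v) (B : Type w) [Ring A] [Algebra k A] [Module.Finite k A]
      [Ring B] [Algebra k B] [Module.Finite k B],
      ¬ IsSemisimpleRing A → ¬ IsSemisimpleRing B →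
      SepRel.IsDirectedAlgebra k A → SepRel.IsSelfInjective B →
      ¬ SepRel.SeparablyRelated k A B) ∧
    (SepRel.JLE k (SepRel.KroneckerAlgebra k) (SepRel.TruncatedPolynomial k 2) ∧
      ¬ SepRel.SeparablyDivides k (SepRel.TruncatedPolynomial k 2) (SepRel.KroneckerAlgebra k)) ∧
    (∀ m n : ℕ, 2 ≤ m → 2 ≤ n →
      SepRel.JLE k (SepRel.TruncatedPolynomial k n) (SepRel.TruncatedLinear k m n) ∧
      ¬ SepRel.SeparablyDivides k (SepRel.TruncatedLinear k m n)
          (SepRel.TruncatedPolynomial k n)) := by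
  refine ⟨fun A B _ _ _ _ _ _ hA hB hA' hB' => hA'.not_separablyRelated hB' hA hB,
    ⟨SepRel.Kronecker.jle k, fun h => ?_⟩, fun m n hm hn =>
    ⟨SepRel.TruncatedLinear.jle k (by omega), fun h => ?_⟩⟩
  -- In both examples the quiver algebra is the triangular one and the truncated polynomial algebra
  -- the self-injective one; only the direction of division differs.
  · let := SepRel.Kronecker.isAcyclicQuiver.partialOrder
    exact (SepRel.Kronecker.isAcyclicQuiver.isTriangular k).not_separablyRelated
      (SepRel.TruncatedPolynomial.isSelfInjective k 2) (SepRel.Kronecker.not_isSemisimpleRing k)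
      (SepRel.TruncatedPolynomial.not_isSemisimpleRing k le_rfl) (Or.inr h)
  · let := (SepRel.LinearQuiver.isAcyclicQuiver (m := m)).partialOrder
    have := SepRel.TruncatedLinear.module_finite k (m := m) (n := n) (by omega)
    exact ((SepRel.LinearQuiver.isAcyclicQuiver.isTriangular k).map
      (Ideal.Quotient.mkₐ k (SepRel.PathAlgebra.arrowIdeal k (SepRel.LinearQuiver m) ^ n))
      (Ideal.Quotient.mkₐ_surjective k _)).not_separablyRelated
      (SepRel.TruncatedPolynomial.isSelfInjective k n)
      (SepRel.TruncatedLinear.not_isSemisimpleRing k hm hn)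
      (SepRel.TruncatedPolynomial.not_isSemisimpleRing k hn) (Or.inl h)
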